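/- Let all random vectors be defined on a probability space, and let the following hypotheses hold. (H1) $\{x_k\}_{k\ge1}$ is a second-order zero-mean process in $\mathbb R^{n_x}$ with $\mathrm{Cov}[x_k,x_s]=A_kB_s^T$ for $1\le s\le k$, where $A_k,B_k\in\mathbb R^{n_x\times p}$. (H2) $\{\gamma_k\}_{k\ge1}$ are independent Bernoulli variables with means $\overline\gamma_k$. (H3) Each $h_k:\mathbb R^{n_x}\to\mathbb R^{n_z}$, $k\ge1$, is analytic. (H4) $v_0$ is a second-order zero-mean vector in $\mathbb R^{n_z}$ with covariance $\Sigma^v_0$. (H5) $\{u_k\}_{k\ge0}$ is a second-order zero-mean white (uncorrelated) sequence with covariances $\Sigma^u_k$, independent of $v_0$; and $v_k=D_{k-1}v_{k-1}+u_{k-1}$ for $k\ge1$, with every $D_k$ non-singular. (H6) $\{w_k\}_{k\ge1}$ is a second-order zero-mean white sequence in $\mathbb R^{n_z}$ with covariances $\Sigma^w_k$. (H7) $\{\lambda_k\}_{k\ge1}$ are independent Bernoulli variables with means $\overline\lambda_k$. (H8) The processes $\{x_k\}_{k\ge1},\{\gamma_k\}_{k\ge1},\{v_k\}_{k\ge1},\{w_k\}_{k\ge1},\{\lambda_k\}_{k\ge1}$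 are mutually independent. Fix a deterministic nominal trajectory $\{x^0_k\}_{k\ge1}$ in $\mathbb R^{n_x}$, let $H_k$ be the Jacobian matrix of $h_k$ at $x_k^0$ and $C_k=h_k(x^0_k)-H_kx^0_k$, and consider, for $k\ge1$, the linearized measurements and the available observations $$z_k=\gamma_k(H_kx_k+C_k)+v_k,\qquad y_k=(1-\lambda_k)z_k+\lambda_kw_k .$$ The least-squares (LS) linear estimator $\widehat\zeta_{/L}$ of a random vector $\zeta$ based on $y_1,\dots,y_L$ is the minimizer of $\mathbb E\|\zeta-Z\|^2$ over all $Z=c+\sum_{j=1}^LM_jy_j$ with deterministic $c,M_j$. The innovation is $\eta_k=y_k-\widehat y_{k/k-1}$, where $\widehat y_{k/k-1}$ is the LS linear estimator of $y_k$ based on $y_1,\dots,y_{k-1}$, and $\Sigma^\eta_k=\mathrm{Cov}[\eta_k]$. Put $E_k=D_{k-1}\cdots D_0$, $\Sigma^v_k=D_{k-1}\Sigma^v_{k-1}D_{k-1}^T+\Sigma^u_{k-1}$, $F_k=\Sigma^v_k(E_k^{-1})^T$, and $$\Gamma^x_k=\overline\gamma_kH_kB_k,\quad \Gamma^v_k=F_k,\quad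 \Delta^x_k=\overline\gamma_kH_kA_k,\quad \Delta^v_k=E_k .$$ Define vectors $e^a_k$ ($a=x,v$) by $e^a_0=0$ and $$e^a_k=e^a_{k-1}+\Psi^a_k(\Sigma^\eta_k)^{-1}\eta_k,\qquad \Psi^a_k=(1-\overline\lambda_k)\big(\Gamma^a_k-\Delta^x_kT^{xa}_{k-1}-\Delta^v_kT^{va}_{k-1}\big)^T,\qquad k\ge1,$$ where $T^{ab}_k=\mathbb E[e^a_k(e^b_k)^T]$ ($a,b=x,v$). Then the innovation process exists, and for every $k\ge1$ such that $\Sigma^\eta_1,\dots,\Sigma^\eta_k$ are non-singular, all the random vectors $z_k,y_k,\eta_k,e^a_k$ are of second order and the following hold (equalities between random vectors being almost sure): $$\eta_k=y_k-(1-\overline\lambda_k)\big(\Delta^x_ke^x_{k-1}+\Delta^v_ke^v_{k-1}+\overline\gamma_kC_k\big),$$ $$\Sigma^\eta_k=\Sigma^y_k-(1-\overline\lambda_k)^2\Big[\big(\Delta^x_kT^{xx}_{k-1}+\Delta^v_kT^{vx}_{k-1}\big)(\Delta^x_k)^T+\big(\Delta^x_kT^{xv}_{k-1}+\Delta^v_kT^{vv}_{k-1}\big)(\Delta^v_k)^T+\overline\gamma_k^2C_kC_k^T\Big],$$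 where $\Sigma^y_k=\mathbb E[y_ky_k^T]$ and $\Sigma^z_k=\mathbb E[z_kz_k^T]$ satisfy $$\Sigma^y_k=(1-\overline\lambda_k)\Sigma^z_k+\overline\lambda_k\Sigma^w_k,\qquad \Sigma^z_k=\overline\gamma_k\big(H_kA_kB_k^TH_k^T+C_kC_k^T\big)+E_kF_k^T;$$ the matrices $T^{ab}_k$ satisfy $$T^{ab}_k=T^{ab}_{k-1}+\Psi^a_k(\Sigma^\eta_k)^{-1}(\Psi^b_k)^T,\qquad T^{ab}_0=0;$$ and the LS linear filter of the signal, that is, the almost surely unique LS linear estimator $\widehat x_{k/k}$ of $x_k$ based on $y_1,\dots,y_k$, is $$\widehat x_{k/k}=A_ke^x_k .$$ -/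

import Mathlib

open MeasureTheory ProbabilityTheory Filter
open scoped Matrix BigOperators

namespace DeceptionFilter

/-- `X` is a second-order random vector: every component is square integrable. -/
def SecondOrder {Ω : Type*} [MeasurableSpace Ω] (P : Measure Ω) {n : ℕ}
    (X : Ω → Fin n → ℝ) : Prop :=
  ∀ i, MemLp (fun ω => X ω i) 2 P

/-- The (centred) cross-covariance matrix `Cov[X, Y]`. -/
noncomputable def covMat {Ω : Type*} [MeasurableSpace Ω] (P : Measure Ω) {n m : ℕ}
    (X : Ω → Fin n → ℝ) (Y : Ω → Fin m → ℝ) : Matrix (Fin n) (Fin m) ℝ :=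
  Matrix.of fun i j => covariance (fun ω => X ω i) (fun ω => Y ω j) P

/-- The second-moment matrix `E[X Yᵀ]`. -/
noncomputable def momMat {Ω : Type*} [MeasurableSpace Ω] (P : Measure Ω) {n m : ℕ}
    (X : Ω → Fin n → ℝ) (Y : Ω → Fin m → ℝ) : Matrix (Fin n) (Fin m) ℝ :=
  Matrix.of fun i j => ∫ ω, X ω i * Y ω j ∂P

/-- The random vector `X` has mean zero. -/
def ZeroMean {Ω : Type*} [MeasurableSpace Ω] (P : Measure Ω) {n : ℕ}
    (X : Ω → Fin n → ℝ) : Prop :=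
  ∀ i, ∫ ω, X ω i ∂P = 0

/-- The mean squared error `E[‖ζ - Z‖²]` (Euclidean norm). -/
noncomputable def mse {Ω : Type*} [MeasurableSpace Ω] (P : Measure Ω) {n : ℕ}
    (ζ Z : Ω → Fin n → ℝ) : ℝ :=
  ∫ ω, ∑ i, (ζ ω i - Z ω i) ^ 2 ∂P

/-- The linear estimate `c + ∑_{1 ≤ j ≤ L} M_j y_j` (with a constant term, because the
observations need not have mean zero). -/
def linEst {Ω : Type*} {n m : ℕ} (y : ℕ → Ω → Fin m → ℝ) (L : ℕ)
    (c : Fin n → ℝ) (M : ℕ → Matrix (Fin n) (Fin m) ℝ) (ω : Ω) : Fin n → ℝ :=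
  c + ∑ j ∈ Finset.Icc 1 L, M j *ᵥ y j ω

/-- `Z` is (a version of) the least-squares linear estimator of `ζ` based on `y_1, …, y_L`. -/
structure IsLSLinearEstimator {Ω : Type*} [MeasurableSpace Ω] (P : Measure Ω) {n m : ℕ}
    (y : ℕ → Ω → Fin m → ℝ) (L : ℕ) (ζ Z : Ω → Fin n → ℝ) : Prop where
  linear : ∃ (c : Fin n → ℝ) (M : ℕ → Matrix (Fin n) (Fin m) ℝ), Z =ᵐ[P] linEst y L c M
  optimal : ∀ (c : Fin n → ℝ) (M : ℕ → Matrix (Fin n) (Fin m) ℝ),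
    mse P ζ Z ≤ mse P ζ (linEst y L c M)

/-- `η` is (a version of) the innovation process of `y`: for each `k ≥ 1`, `η_k = y_k - ŷ_{k/k-1}`
where `ŷ_{k/k-1}` is the least-squares linear estimator of `y_k` based on `y_1, …, y_{k-1}`. -/
def IsInnovation {Ω : Type*} [MeasurableSpace Ω] (P : Measure Ω) {m : ℕ}
    (y η : ℕ → Ω → Fin m → ℝ) : Prop :=
  ∀ k, 1 ≤ k → IsLSLinearEstimator P y (k - 1) (y k) (fun ω => y k ω - η k ω)

/-- The labels `x` (signal) and `v` (additive noise). -/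
inductive Label
  | x
  | v

/-- The dimension of the vector `e^a_k`: `p` for `a = x`, and `n_z` for `a = v`. -/
abbrev Label.dim (p nz : ℕ) : Label → ℕ
  | .x => p
  | .v => nz

/-- The labels of the five processes whose mutual independence is required. -/
inductive Proc
  | signal
  | gam
  | noise
  | attack
  | lam

/-- The data of the observation model. Quantities that the model only uses at times `k ≥ 1`
are indexed by `ℕ` as well; their value at `0` plays no role. -/
structure Model (Ω : Type*) (nx nz p : ℕ) where
  /-- signal process `x_k`, `k ≥ 1` -/
  x : ℕ → Ω → Fin nx → ℝ
  /-- Bernoulli variables `γ_k`, `k ≥ 1` -/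
  gam : ℕ → Ω → ℝ
  /-- time-correlated noise `v_k`, `k ≥ 0` -/
  v : ℕ → Ω → Fin nz → ℝ
  /-- noise `u_k`, `k ≥ 0`, driving `v` -/
  u : ℕ → Ω → Fin nz → ℝ
  /-- attack noise `w_k`, `k ≥ 1` -/
  w : ℕ → Ω → Fin nz → ℝ
  /-- Bernoulli variables `λ_k`, `k ≥ 1` -/
  lam : ℕ → Ω → ℝ
  /-- first factor of the signal covariance -/
  A : ℕ → Matrix (Fin nx) (Fin p) ℝ
  /-- second factor of the signal covariance -/
  B : ℕ → Matrix (Fin nx) (Fin p) ℝ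
  /-- transition matrices of `v` -/
  D : ℕ → Matrix (Fin nz) (Fin nz) ℝ
  /-- covariance of `v_0` -/
  SigmaV0 : Matrix (Fin nz) (Fin nz) ℝ
  /-- covariance of `u_k` -/
  SigmaU : ℕ → Matrix (Fin nz) (Fin nz) ℝ
  /-- covariance of `w_k` -/
  SigmaW : ℕ → Matrix (Fin nz) (Fin nz) ℝ
  /-- mean of `γ_k` -/
  gamBar : ℕ → ℝ
  /-- mean of `λ_k` -/
  lamBar : ℕ → ℝ
  /-- measurement functions `h_k` -/
  h : ℕ → (Fin nx → ℝ) → (Fin nz → ℝ)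
  /-- nominal trajectory `x_k^0` -/
  x0 : ℕ → Fin nx → ℝ

namespace Model

variable {Ω : Type*} {nx nz p : ℕ}

/-- The σ-algebra generated by each of the five processes (over the times `k ≥ 1`). -/
abbrev sigmaAlg (M : Model Ω nx nz p) : Proc → MeasurableSpace Ω
  | .signal => ⨆ k : Set.Ici (1 : ℕ), MeasurableSpace.comap (M.x k) inferInstance
  | .gam => ⨆ k : Set.Ici (1 : ℕ), MeasurableSpace.comap (M.gam k) inferInstance
  | .noise => ⨆ k : Set.Ici (1 : ℕ), MeasurableSpace.comap (M.v k) inferInstance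
  | .attack => ⨆ k : Set.Ici (1 : ℕ), MeasurableSpace.comap (M.w k) inferInstance
  | .lam => ⨆ k : Set.Ici (1 : ℕ), MeasurableSpace.comap (M.lam k) inferInstance

/-- The standing hypotheses of the model. -/
structure Hyp [MeasurableSpace Ω] (M : Model Ω nx nz p) (P : Measure Ω) : Prop where
  -- all the processes consist of random variables
  meas_x : ∀ k, 1 ≤ k → Measurable (M.x k)
  meas_gam : ∀ k, 1 ≤ k → Measurable (M.gam k)
  meas_v : ∀ k, Measurable (M.v k)
  meas_u : ∀ k, Measurable (M.u k)
  meas_w : ∀ k, 1 ≤ k → Measurable (M.w k)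
  meas_lam : ∀ k, 1 ≤ k → Measurable (M.lam k)
  -- the signal: second order, zero mean, factorized covariance
  signal_secondOrder : ∀ k, 1 ≤ k → SecondOrder P (M.x k)
  signal_zeroMean : ∀ k, 1 ≤ k → ZeroMean P (M.x k)
  signal_cov : ∀ k s, 1 ≤ s → s ≤ k → covMat P (M.x k) (M.x s) = M.A k * (M.B s)ᵀ
  -- the Bernoulli variables of the uncertain measurements
  gam_indep : iIndepFun (fun k : Set.Ici (1 : ℕ) => M.gam k) P
  gam_bernoulli : ∀ k, 1 ≤ k → ∀ᵐ ω ∂P, M.gam k ω = 0 ∨ M.gam k ω = 1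
  gam_mean : ∀ k, 1 ≤ k → ∫ ω, M.gam k ω ∂P = M.gamBar k
  -- the measurement functions
  h_analytic : ∀ k, 1 ≤ k → AnalyticOnNhd ℝ (M.h k) Set.univ
  -- the first-order Markov model of the additive noise
  markov : ∀ k, ∀ᵐ ω ∂P, M.v (k + 1) ω = M.D k *ᵥ M.v k ω + M.u k ω
  D_nonsingular : ∀ k, IsUnit (M.D k).det
  -- the initial noise vector
  v0_secondOrder : SecondOrder P (M.v 0)
  v0_zeroMean : ZeroMean P (M.v 0)
  v0_cov : covMat P (M.v 0) (M.v 0) = M.SigmaV0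
  -- the white noise driving the additive noise
  u_secondOrder : ∀ k, SecondOrder P (M.u k)
  u_zeroMean : ∀ k, ZeroMean P (M.u k)
  u_cov : ∀ k, covMat P (M.u k) (M.u k) = M.SigmaU k
  u_white : ∀ k s, k ≠ s → covMat P (M.u k) (M.u s) = 0
  u_indep : Indep (⨆ k, MeasurableSpace.comap (M.u k) inferInstance)
    (MeasurableSpace.comap (M.v 0) inferInstance) P
  -- the white attack noise
  w_secondOrder : ∀ k, 1 ≤ k → SecondOrder P (M.w k)
  w_zeroMean : ∀ k, 1 ≤ k → ZeroMean P (M.w k)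
  w_cov : ∀ k, 1 ≤ k → covMat P (M.w k) (M.w k) = M.SigmaW k
  w_white : ∀ k s, 1 ≤ k → 1 ≤ s → k ≠ s → covMat P (M.w k) (M.w s) = 0
  -- the Bernoulli variables of the attacks
  lam_indep : iIndepFun (fun k : Set.Ici (1 : ℕ) => M.lam k) P
  lam_bernoulli : ∀ k, 1 ≤ k → ∀ᵐ ω ∂P, M.lam k ω = 0 ∨ M.lam k ω = 1
  lam_mean : ∀ k, 1 ≤ k → ∫ ω, M.lam k ω ∂P = M.lamBar k
  -- mutual independence of the five processes
  mutual_indep : iIndep M.sigmaAlg P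

/-- `H_k`: the Jacobian matrix of `h_k` at the nominal point `x_k^0`. -/
noncomputable def H (M : Model Ω nx nz p) (k : ℕ) : Matrix (Fin nz) (Fin nx) ℝ :=
  LinearMap.toMatrix' (fderiv ℝ (M.h k) (M.x0 k)).toLinearMap

/-- `C_k = h_k(x_k^0) - H_k x_k^0`. -/
noncomputable def C (M : Model Ω nx nz p) (k : ℕ) : Fin nz → ℝ :=
  M.h k (M.x0 k) - M.H k *ᵥ M.x0 k

/-- The linearized measurements `z_k = γ_k (H_k x_k + C_k) + v_k`. -/
noncomputable def z (M : Model Ω nx nz p) (k : ℕ) (ω : Ω) : Fin nz → ℝ :=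
  M.gam k ω • (M.H k *ᵥ M.x k ω + M.C k) + M.v k ω

/-- The available observations `y_k = (1 - λ_k) z_k + λ_k w_k`. -/
noncomputable def y (M : Model Ω nx nz p) (k : ℕ) (ω : Ω) : Fin nz → ℝ :=
  (1 - M.lam k ω) • M.z k ω + M.lam k ω • M.w k ω

/-- `E_k = D_{k-1} ⋯ D_0`. -/
def E (M : Model Ω nx nz p) : ℕ → Matrix (Fin nz) (Fin nz) ℝ
  | 0 => 1
  | k + 1 => M.D k * M.E k

/-- `Σ^v_k`, given by `Σ^v_k = D_{k-1} Σ^v_{k-1} D_{k-1}ᵀ + Σ^u_{k-1}`. -/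
def SigmaV (M : Model Ω nx nz p) : ℕ → Matrix (Fin nz) (Fin nz) ℝ
  | 0 => M.SigmaV0
  | k + 1 => M.D k * M.SigmaV k * (M.D k)ᵀ + M.SigmaU k

/-- `F_k = Σ^v_k (E_k⁻¹)ᵀ`. -/
noncomputable def F (M : Model Ω nx nz p) (k : ℕ) : Matrix (Fin nz) (Fin nz) ℝ :=
  M.SigmaV k * ((M.E k)⁻¹)ᵀ

/-- `Γ^x_k = γ̄_k H_k B_k` and `Γ^v_k = F_k`. -/
noncomputable def Gam (M : Model Ω nx nz p) :
    (a : Label) → ℕ → Matrix (Fin nz) (Fin (a.dim p nz)) ℝ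
  | .x, k => M.gamBar k • (M.H k * M.B k)
  | .v, k => M.F k

/-- `Δ^x_k = γ̄_k H_k A_k` and `Δ^v_k = E_k`. -/
noncomputable def Del (M : Model Ω nx nz p) :
    (a : Label) → ℕ → Matrix (Fin nz) (Fin (a.dim p nz)) ℝ
  | .x, k => M.gamBar k • (M.H k * M.A k)
  | .v, k => M.E k

/-- `(1 - λ̄_k) (Γ^a_k - Δ^x_k T^{xa} - Δ^v_k T^{va})ᵀ`, for a given family of matrices `T^{ab}`. -/
noncomputable def gain (M : Model Ω nx nz p)
    (T : (a b : Label) → Matrix (Fin (a.dim p nz)) (Fin (b.dim p nz)) ℝ)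
    (a : Label) (k : ℕ) : Matrix (Fin (a.dim p nz)) (Fin nz) ℝ :=
  (1 - M.lamBar k) • (M.Gam a k - M.Del .x k * T .x a - M.Del .v k * T .v a)ᵀ

variable [MeasurableSpace Ω]

/-- The vectors `e^a_k`, built from a process `η` by `e^a_0 = 0` and
`e^a_k = e^a_{k-1} + Ψ^a_k (Σ^η_k)⁻¹ η_k`, where `Σ^η_k = Cov[η_k]` and `Ψ^a_k` is the gain
obtained from the matrices `E[e^a_{k-1} (e^b_{k-1})ᵀ]`. -/
noncomputable def e (M : Model Ω nx nz p) (P : Measure Ω) (η : ℕ → Ω → Fin nz → ℝ) :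
    ℕ → (a : Label) → Ω → Fin (a.dim p nz) → ℝ
  | 0 => fun _ _ => 0
  | k + 1 => fun a ω => M.e P η k a ω +
      (M.gain (fun b c => momMat P (M.e P η k b) (M.e P η k c)) a (k + 1) *
        (covMat P (η (k + 1)) (η (k + 1)))⁻¹) *ᵥ η (k + 1) ω

/-- `T^{ab}_k = E[e^a_k (e^b_k)ᵀ]`. -/
noncomputable def T (M : Model Ω nx nz p) (P : Measure Ω) (η : ℕ → Ω → Fin nz → ℝ)
    (k : ℕ) (a b : Label) : Matrix (Fin (a.dim p nz)) (Fin (b.dim p nz)) ℝ :=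
  momMat P (M.e P η k a) (M.e P η k b)

/-- `Ψ^a_k = (1 - λ̄_k) (Γ^a_k - Δ^x_k T^{xa}_{k-1} - Δ^v_k T^{va}_{k-1})ᵀ`, for `k ≥ 1`. -/
noncomputable def Psi (M : Model Ω nx nz p) (P : Measure Ω) (η : ℕ → Ω → Fin nz → ℝ)
    (a : Label) (k : ℕ) : Matrix (Fin (a.dim p nz)) (Fin nz) ℝ :=
  M.gain (M.T P η (k - 1)) a k

end Model

end DeceptionFilter

/-! Everything rests on the orthogonality principle: an affine function of the observations whose
error has mean zero and is uncorrelated with every observation is, up to null sets, the unique LS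
linear estimator (`isLSLinearEstimator_iff_ae_eq`, by Pythagoras). Such a function always exists, by
projection onto a finite-dimensional subspace of L², so innovations exist without any rank
condition.

A recursion is possible because the relevant covariances separate in time. For the signal this is a
hypothesis; for the noise, E[v_k v_sᵀ] = E_k E_s⁻¹ Σ^v_s = E_k F_sᵀ when s ≤ k (`momMat_v_v`).
Independence replaces the Bernoulli factors by means, and centring y_k cancels the C terms at
distinct times. Hence x_k (for s ≤ k) and the centred y_k (for s < k) have covariances with y_s of
the form (1 - λ̄_s)(Gx (Γ^x_s)ᵀ + Gv (Γ^v_s)ᵀ), where Gx and Gv do not depend on s (`momMat_x_y`,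
`momMat_y_sub_yMean`). This is `HasFactors`.

The induction invariant `IsSufficientAt` says that every such ζ is estimated by Gx e^x_k + Gv e^v_k.
To propagate it (`isSufficientAt_succ`), apply it to the centred y_{k+1}: this makes η_{k+1}
explicit and gives E[ζ η_{k+1}ᵀ] = Gx Ψ^x_{k+1} + Gv Ψ^v_{k+1} (`momMat_innovation`). Adding this
matrix times (Σ^η_{k+1})⁻¹ η_{k+1} to the estimate removes the correlation of the error with the
only new direction. The filter is the case ζ = x_k, Gx = A_k, Gv = 0; the formulas for Σ^η and T
come from expanding second moments of sums with uncorrelated terms. -/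

namespace DeceptionFilter

/-! ### Calculus of second-moment matrices. -/

section Moments

variable {Ω : Type*} [MeasurableSpace Ω] {P : Measure Ω} {n m l : ℕ}

theorem SecondOrder.add {X Y : Ω → Fin n → ℝ} (hX : SecondOrder P X) (hY : SecondOrder P Y) :
    SecondOrder P (fun ω => X ω + Y ω) := fun i => (hX i).add (hY i)

theorem SecondOrder.sub {X Y : Ω → Fin n → ℝ} (hX : SecondOrder P X) (hY : SecondOrder P Y) :
    SecondOrder P (fun ω => X ω - Y ω) := fun i => (hX i).sub (hY i)

theorem SecondOrder.mulVec (A : Matrix (Fin m) (Fin n) ℝ) {X : Ω → Fin n → ℝ}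
    (hX : SecondOrder P X) : SecondOrder P (fun ω => A *ᵥ X ω) := fun i => by
  simp only [Matrix.mulVec, dotProduct]
  exact memLp_finsetSum _ fun j _ => (hX j).const_mul _

theorem SecondOrder.const [IsFiniteMeasure P] (c : Fin n → ℝ) :
    SecondOrder P (fun _ : Ω => c) := fun _ => memLp_const _

theorem SecondOrder.congr {X Y : Ω → Fin n → ℝ} (hX : SecondOrder P X) (h : X =ᵐ[P] Y) :
    SecondOrder P Y := fun i =>
  (memLp_congr_ae (h.mono fun ω hω => by simp only [hω])).1 (hX i)

theorem SecondOrder.finset_sum {ι : Type*} {s : Finset ι} {X : ι → Ω → Fin n → ℝ}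
    (hX : ∀ i ∈ s, SecondOrder P (X i)) : SecondOrder P (fun ω => ∑ i ∈ s, X i ω) := fun j => by
  simp only [Finset.sum_apply]
  exact memLp_finsetSum _ fun i hi => hX i hi j

/-- Multiplication by an essentially bounded scalar preserves second-order vectors. -/
theorem SecondOrder.smul_of_bound {f : Ω → ℝ} {X : Ω → Fin n → ℝ} (hX : SecondOrder P X)
    (hf : AEStronglyMeasurable f P) (C : ℝ) (hC : ∀ᵐ ω ∂P, ‖f ω‖ ≤ C) :
    SecondOrder P (fun ω => f ω • X ω) := fun i => by
  have h := (hX i).mul (memLp_top_of_bound hf C hC) (r := 2)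
  exact h

theorem SecondOrder.integrable_mul {X : Ω → Fin n → ℝ} {Y : Ω → Fin m → ℝ}
    (hX : SecondOrder P X) (hY : SecondOrder P Y) (i : Fin n) (j : Fin m) :
    Integrable (fun ω => X ω i * Y ω j) P := (hX i).integrable_mul (hY j)

theorem SecondOrder.integrable [IsFiniteMeasure P] {X : Ω → Fin n → ℝ} (hX : SecondOrder P X)
    (i : Fin n) : Integrable (fun ω => X ω i) P := (hX i).integrable (by norm_num)

theorem ZeroMean.add [IsFiniteMeasure P] {X Y : Ω → Fin n → ℝ} (sX : SecondOrder P X)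
    (sY : SecondOrder P Y) (hX : ZeroMean P X) (hY : ZeroMean P Y) :
    ZeroMean P (fun ω => X ω + Y ω) := fun i => by
  simp only [Pi.add_apply]
  rw [integral_add (sX.integrable i) (sY.integrable i), hX i, hY i, add_zero]

theorem ZeroMean.sub [IsFiniteMeasure P] {X Y : Ω → Fin n → ℝ} (sX : SecondOrder P X)
    (sY : SecondOrder P Y) (hX : ZeroMean P X) (hY : ZeroMean P Y) :
    ZeroMean P (fun ω => X ω - Y ω) := fun i => by
  simp only [Pi.sub_apply]
  rw [integral_sub (sX.integrable i) (sY.integrable i), hX i, hY i, sub_zero]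

theorem ZeroMean.mulVec [IsFiniteMeasure P] (A : Matrix (Fin m) (Fin n) ℝ) {X : Ω → Fin n → ℝ}
    (sX : SecondOrder P X) (hX : ZeroMean P X) : ZeroMean P (fun ω => A *ᵥ X ω) := fun i => by
  simp only [Matrix.mulVec, dotProduct]
  rw [integral_finsetSum _ fun j _ => (sX.integrable j).const_mul _]
  simp only [integral_const_mul]
  exact Finset.sum_eq_zero fun j _ => by rw [hX j, mul_zero]

theorem ZeroMean.congr {X Y : Ω → Fin n → ℝ} (hX : ZeroMean P X) (h : X =ᵐ[P] Y) :
    ZeroMean P Y := fun i => by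
  rw [← hX i]
  exact integral_congr_ae (h.mono fun ω hω => by simp only [hω])

theorem momMat_transpose (X : Ω → Fin n → ℝ) (Y : Ω → Fin m → ℝ) :
    (momMat P X Y)ᵀ = momMat P Y X := by
  ext i j
  simp [momMat, mul_comm]

theorem momMat_congr {X X' : Ω → Fin n → ℝ} {Y Y' : Ω → Fin m → ℝ} (hX : X =ᵐ[P] X')
    (hY : Y =ᵐ[P] Y') : momMat P X Y = momMat P X' Y' := by
  ext i j
  simp only [momMat, Matrix.of_apply]
  refine integral_congr_ae ?_
  filter_upwards [hX, hY] with ω h1 h2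
  rw [h1, h2]

theorem momMat_add_left {X X' : Ω → Fin n → ℝ} {Y : Ω → Fin m → ℝ} (hX : SecondOrder P X)
    (hX' : SecondOrder P X') (hY : SecondOrder P Y) :
    momMat P (fun ω => X ω + X' ω) Y = momMat P X Y + momMat P X' Y := by
  ext i j
  simp only [momMat, Matrix.of_apply, Pi.add_apply, Matrix.add_apply, add_mul]
  exact integral_add (hX.integrable_mul hY i j) (hX'.integrable_mul hY i j)

theorem momMat_sub_left {X X' : Ω → Fin n → ℝ} {Y : Ω → Fin m → ℝ} (hX : SecondOrder P X)
    (hX' : SecondOrder P X') (hY : SecondOrder P Y) :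
    momMat P (fun ω => X ω - X' ω) Y = momMat P X Y - momMat P X' Y := by
  ext i j
  simp only [momMat, Matrix.of_apply, Pi.sub_apply, Matrix.sub_apply, sub_mul]
  exact integral_sub (hX.integrable_mul hY i j) (hX'.integrable_mul hY i j)

theorem momMat_mulVec_left (A : Matrix (Fin l) (Fin n) ℝ) {X : Ω → Fin n → ℝ}
    {Y : Ω → Fin m → ℝ} (hX : SecondOrder P X) (hY : SecondOrder P Y) :
    momMat P (fun ω => A *ᵥ X ω) Y = A * momMat P X Y := by
  ext i j
  simp only [momMat, Matrix.of_apply, Matrix.mul_apply, Matrix.mulVec, dotProduct,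
    Finset.sum_mul, mul_assoc]
  rw [integral_finsetSum _ fun k _ => (hX.integrable_mul hY k j).const_mul _]
  simp only [integral_const_mul]

theorem momMat_add_right {X : Ω → Fin n → ℝ} {Y Y' : Ω → Fin m → ℝ} (hX : SecondOrder P X)
    (hY : SecondOrder P Y) (hY' : SecondOrder P Y') :
    momMat P X (fun ω => Y ω + Y' ω) = momMat P X Y + momMat P X Y' := by
  rw [← momMat_transpose, momMat_add_left hY hY' hX, Matrix.transpose_add, momMat_transpose,
    momMat_transpose]

theorem momMat_sub_right {X : Ω → Fin n → ℝ} {Y Y' : Ω → Fin m → ℝ} (hX : SecondOrder P X)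
    (hY : SecondOrder P Y) (hY' : SecondOrder P Y') :
    momMat P X (fun ω => Y ω - Y' ω) = momMat P X Y - momMat P X Y' := by
  rw [← momMat_transpose, momMat_sub_left hY hY' hX, Matrix.transpose_sub, momMat_transpose,
    momMat_transpose]

theorem momMat_mulVec_right (A : Matrix (Fin l) (Fin m) ℝ) {X : Ω → Fin n → ℝ}
    {Y : Ω → Fin m → ℝ} (hX : SecondOrder P X) (hY : SecondOrder P Y) :
    momMat P X (fun ω => A *ᵥ Y ω) = momMat P X Y * Aᵀ := by
  rw [← momMat_transpose, momMat_mulVec_left A hY hX, Matrix.transpose_mul, momMat_transpose]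

theorem momMat_const_right {X : Ω → Fin n → ℝ} (hX : ZeroMean P X) (c : Fin m → ℝ) :
    momMat P X (fun _ => c) = 0 := by
  ext i j
  simp only [momMat, Matrix.of_apply, Matrix.zero_apply, integral_mul_const, hX i, zero_mul]

theorem momMat_const_left {X : Ω → Fin n → ℝ} (hX : ZeroMean P X) (c : Fin m → ℝ) :
    momMat P (fun _ => c) X = 0 := by
  rw [← momMat_transpose, momMat_const_right hX, Matrix.transpose_zero]

theorem momMat_const_const [IsProbabilityMeasure P] (c : Fin n → ℝ) (d : Fin m → ℝ) :
    momMat P (fun _ => c) (fun _ => d) = Matrix.vecMulVec c d := by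
  ext i j
  simp [momMat, Matrix.vecMulVec_apply]

theorem momMat_sum_right {ι : Type*} {s : Finset ι} {X : Ω → Fin n → ℝ}
    {Y : ι → Ω → Fin m → ℝ} (hX : SecondOrder P X) (hY : ∀ i ∈ s, SecondOrder P (Y i)) :
    momMat P X (fun ω => ∑ i ∈ s, Y i ω) = ∑ i ∈ s, momMat P X (Y i) := by
  ext a b
  simp only [momMat, Matrix.of_apply, Finset.sum_apply, Finset.mul_sum, Matrix.sum_apply]
  exact integral_finsetSum _ fun i hi => hX.integrable_mul (hY i hi) a b

/-- For vectors with a zero-mean first member, covariances are second moments. -/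
theorem covMat_eq_momMat [IsProbabilityMeasure P] {X : Ω → Fin n → ℝ} {Y : Ω → Fin m → ℝ}
    (sX : SecondOrder P X) (sY : SecondOrder P Y) (hX : ZeroMean P X) :
    covMat P X Y = momMat P X Y := by
  ext i j
  simp only [covMat, momMat, Matrix.of_apply]
  rw [covariance_eq_sub (sX i) (sY j), hX i, zero_mul, sub_zero]
  rfl

theorem covMat_transpose (X : Ω → Fin n → ℝ) (Y : Ω → Fin m → ℝ) :
    (covMat P X Y)ᵀ = covMat P Y X := by
  ext i j
  simp only [covMat, Matrix.transpose_apply, Matrix.of_apply]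
  exact covariance_comm _ _

end Moments

end DeceptionFilter

namespace DeceptionFilter

/-! ### Least-squares linear estimation and the orthogonality principle. -/

section LeastSquares

variable {Ω : Type*} [MeasurableSpace Ω] {P : Measure Ω} {n m l : ℕ}

/-- Normal equations: a square-integrable `f` has a linear approximation by finitely many
square-integrable functions whose error is orthogonal to all of them. -/
theorem exists_orthogonal_sub_sum {ι : Type*} (s : Finset ι) {f : Ω → ℝ} {g : ι → Ω → ℝ}
    (hf : MemLp f 2 P) (hg : ∀ i ∈ s, MemLp (g i) 2 P) :
    ∃ a : ι → ℝ, ∀ i ∈ s, ∫ ω, (f ω - ∑ j ∈ s, a j * g j ω) * g i ω ∂P = 0 := by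
  classical
  let G : s → Lp ℝ 2 P := fun i => (hg i i.2).toLp (g i)
  -- The coefficients are those of the orthogonal projection of `f` onto this span, which exists
  -- because the span is finite-dimensional. The generators may be dependent.
  let S : Submodule ℝ (Lp ℝ 2 P) := Submodule.span ℝ (Set.range G)
  have : FiniteDimensional ℝ S := FiniteDimensional.span_of_finite ℝ (Set.finite_range G)
  obtain ⟨c, hc⟩ := (Submodule.mem_span_range_iff_exists_fun ℝ).1
    (S.starProjection_apply_mem (hf.toLp f))
  let a : ι → ℝ := fun i => if h : i ∈ s then c ⟨i, h⟩ else 0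
  refine ⟨a, fun i hi => ?_⟩
  have key := S.starProjection_inner_eq_zero (hf.toLp f) (G ⟨i, hi⟩)
    (Submodule.subset_span ⟨⟨i, hi⟩, rfl⟩)
  rw [← hc, L2.inner_def] at key
  rw [← key]
  have hsum : (⇑(∑ j : s, c j • G j) : Ω → ℝ) =ᵐ[P] fun ω => ∑ j ∈ s, a j * g j ω := by
    have hG : ∀ᵐ ω ∂P, ∀ j : s, (c j • G j : Lp ℝ 2 P) ω = c j * g j ω := by
      refine ae_all_iff.2 fun j => ?_
      filter_upwards [Lp.coeFn_smul (c j) (G j), (hg j j.2).coeFn_toLp] with ω h1 h2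
      rw [h1, Pi.smul_apply, h2, smul_eq_mul]
    filter_upwards [Lp.coeFn_finsetSum Finset.univ (fun j : s => c j • G j), hG] with ω h1 h2
    rw [h1, Finset.sum_apply, ← Finset.sum_coe_sort s]
    exact Finset.sum_congr rfl fun j _ => by rw [h2]; simp [a]
  refine integral_congr_ae ?_
  filter_upwards [hsum, hf.coeFn_toLp, (hg i hi).coeFn_toLp,
    Lp.coeFn_sub (hf.toLp f) (∑ j : s, c j • G j)] with ω h1 h2 h3 h4
  rw [h4, Pi.sub_apply, h1, h2]
  simp only [G]
  rw [h3]
  simp [mul_comm]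

/-- `Z` is almost surely an affine combination of `y_1, …, y_L`. -/
def IsAffineIn (P : Measure Ω) (y : ℕ → Ω → Fin m → ℝ) (L : ℕ) (Z : Ω → Fin n → ℝ) : Prop :=
  ∃ (c : Fin n → ℝ) (K : ℕ → Matrix (Fin n) (Fin m) ℝ), Z =ᵐ[P] linEst y L c K

/-- `R` has mean zero and is uncorrelated with `y_1, …, y_L`. -/
structure IsOrthTo (P : Measure Ω) (y : ℕ → Ω → Fin m → ℝ) (L : ℕ) (R : Ω → Fin n → ℝ) :
    Prop where
  secondOrder : SecondOrder P R
  zeroMean : ZeroMean P R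
  momMat_eq_zero : ∀ j, 1 ≤ j → j ≤ L → momMat P R (y j) = 0

variable {y : ℕ → Ω → Fin m → ℝ} {L : ℕ}

theorem IsAffineIn.const (c : Fin n → ℝ) : IsAffineIn P y L fun _ => c :=
  ⟨c, 0, Eventually.of_forall fun ω => by simp [linEst]⟩

theorem IsAffineIn.add {Z Z' : Ω → Fin n → ℝ} (h : IsAffineIn P y L Z)
    (h' : IsAffineIn P y L Z') : IsAffineIn P y L fun ω => Z ω + Z' ω := by
  obtain ⟨c, K, h⟩ := h
  obtain ⟨c', K', h'⟩ := h'
  refine ⟨c + c', K + K', ?_⟩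
  filter_upwards [h, h'] with ω h1 h2
  rw [h1, h2]
  simp only [linEst, Pi.add_apply, Matrix.add_mulVec, Finset.sum_add_distrib]
  abel

theorem IsAffineIn.mulVec (A : Matrix (Fin l) (Fin n) ℝ) {Z : Ω → Fin n → ℝ}
    (h : IsAffineIn P y L Z) : IsAffineIn P y L fun ω => A *ᵥ Z ω := by
  obtain ⟨c, K, h⟩ := h
  refine ⟨A *ᵥ c, fun j => A * K j, ?_⟩
  filter_upwards [h] with ω h1
  rw [h1]
  simp only [linEst, Matrix.mulVec_add, Matrix.mulVec_sum, Matrix.mulVec_mulVec]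

theorem IsAffineIn.sub {Z Z' : Ω → Fin n → ℝ} (h : IsAffineIn P y L Z)
    (h' : IsAffineIn P y L Z') : IsAffineIn P y L fun ω => Z ω - Z' ω := by
  have := h.add (h'.mulVec (-1))
  simpa [Matrix.neg_mulVec, sub_eq_add_neg] using this

theorem IsAffineIn.congr {Z Z' : Ω → Fin n → ℝ} (h : IsAffineIn P y L Z) (hZ : Z =ᵐ[P] Z') :
    IsAffineIn P y L Z' := by
  obtain ⟨c, K, h⟩ := h
  exact ⟨c, K, hZ.symm.trans h⟩

theorem IsAffineIn.mono {L' : ℕ} (hL : L ≤ L') {Z : Ω → Fin n → ℝ} (h : IsAffineIn P y L Z) :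
    IsAffineIn P y L' Z := by
  obtain ⟨c, K, h⟩ := h
  refine ⟨c, fun j => if j ≤ L then K j else 0, ?_⟩
  filter_upwards [h] with ω h1
  rw [h1]
  simp only [linEst]
  congr 1
  rw [← Finset.sum_subset (Finset.Icc_subset_Icc_right hL)]
  · exact Finset.sum_congr rfl fun j hj => by rw [if_pos (Finset.mem_Icc.1 hj).2]
  · intro j hj hj'
    have : ¬ j ≤ L := fun h => hj' (Finset.mem_Icc.2 ⟨(Finset.mem_Icc.1 hj).1, h⟩)
    rw [if_neg this, Matrix.zero_mulVec]

theorem IsAffineIn.observation {j : ℕ} (h1 : 1 ≤ j) (hj : j ≤ L) : IsAffineIn P y L (y j) := by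
  refine ⟨0, fun i => if i = j then 1 else 0, Eventually.of_forall fun ω => ?_⟩
  simp only [linEst, zero_add]
  rw [Finset.sum_eq_single_of_mem j (Finset.mem_Icc.2 ⟨h1, hj⟩)]
  · simp
  · intro i _ hij
    simp [hij]

theorem secondOrder_linEst [IsFiniteMeasure P]
    (hy : ∀ j, 1 ≤ j → j ≤ L → SecondOrder P (y j)) (c : Fin n → ℝ)
    (K : ℕ → Matrix (Fin n) (Fin m) ℝ) : SecondOrder P (linEst y L c K) :=
  (SecondOrder.const c).add (SecondOrder.finset_sum fun j hj =>
    (hy j (Finset.mem_Icc.1 hj).1 (Finset.mem_Icc.1 hj).2).mulVec _)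

theorem IsAffineIn.secondOrder [IsFiniteMeasure P]
    (hy : ∀ j, 1 ≤ j → j ≤ L → SecondOrder P (y j)) {Z : Ω → Fin n → ℝ}
    (h : IsAffineIn P y L Z) : SecondOrder P Z := by
  obtain ⟨c, K, h⟩ := h
  exact (secondOrder_linEst hy c K).congr h.symm

/-- Mean zero disposes of the constant term, and orthogonality to each observation of the linear
terms. -/
theorem IsOrthTo.momMat_affine [IsFiniteMeasure P]
    (hy : ∀ j, 1 ≤ j → j ≤ L → SecondOrder P (y j)) {R : Ω → Fin n → ℝ} {Z : Ω → Fin l → ℝ}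
    (hR : IsOrthTo P y L R) (hZ : IsAffineIn P y L Z) : momMat P R Z = 0 := by
  obtain ⟨c, K, hZ⟩ := hZ
  rw [momMat_congr (EventuallyEq.refl _ R) hZ]
  have hs : ∀ j ∈ Finset.Icc 1 L, SecondOrder P fun ω => K j *ᵥ y j ω := fun j hj =>
    (hy j (Finset.mem_Icc.1 hj).1 (Finset.mem_Icc.1 hj).2).mulVec _
  have h := momMat_add_right hR.secondOrder (SecondOrder.const c) (SecondOrder.finset_sum hs)
  refine h.trans ?_
  rw [momMat_const_right hR.zeroMean, momMat_sum_right hR.secondOrder hs, zero_add]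
  refine Finset.sum_eq_zero fun j hj => ?_
  obtain ⟨h1, h2⟩ := Finset.mem_Icc.1 hj
  rw [momMat_mulVec_right _ hR.secondOrder (hy j h1 h2), hR.momMat_eq_zero j h1 h2,
    Matrix.zero_mul]

theorem IsOrthTo.congr {R R' : Ω → Fin n → ℝ} (hR : IsOrthTo P y L R) (h : R =ᵐ[P] R') :
    IsOrthTo P y L R' where
  secondOrder := hR.secondOrder.congr h
  zeroMean := hR.zeroMean.congr h
  momMat_eq_zero j h1 h2 := by
    rw [← momMat_congr h (EventuallyEq.refl _ (y j)), hR.momMat_eq_zero j h1 h2]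

/-- Existence of a linear estimator whose error satisfies the orthogonality principle. -/
theorem exists_affine_isOrthTo [IsFiniteMeasure P]
    (hy : ∀ j, 1 ≤ j → j ≤ L → SecondOrder P (y j)) {ζ : Ω → Fin n → ℝ}
    (hζ : SecondOrder P ζ) :
    ∃ Z, IsAffineIn P y L Z ∧ IsOrthTo P y L fun ω => ζ ω - Z ω := by
  -- The index `none` carries the constant function 1: its coefficient is the constant term of the
  -- estimator, and orthogonality to it is the mean-zero condition on the error.
  let g : Option (ℕ × Fin m) → Ω → ℝ := fun o => o.elim (fun _ => 1) fun q ω => y q.1 ω q.2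
  let s : Finset (Option (ℕ × Fin m)) :=
    Finset.insertNone (Finset.Icc 1 L ×ˢ (Finset.univ : Finset (Fin m)))
  have hg : ∀ o ∈ s, MemLp (g o) 2 P := by
    rintro (_ | ⟨j, i⟩) ho
    · exact memLp_const _
    · simp only [s, Finset.some_mem_insertNone, Finset.mem_product, Finset.mem_Icc] at ho
      exact hy j ho.1.1 ho.1.2 i
  choose a ha using fun i => exists_orthogonal_sub_sum s (hζ i) hg
  have hrepr : ∀ i ω, ∑ o ∈ s, a i o * g o ω =
      linEst y L (fun i => a i none) (fun j => Matrix.of fun i q => a i (some (j, q))) ω i := by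
    intro i ω
    simp only [s, Finset.sum_insertNone, Finset.sum_product, linEst, Pi.add_apply,
      Finset.sum_apply, Matrix.mulVec, dotProduct, Matrix.of_apply, g, Option.elim, mul_one]
  refine ⟨_, ⟨fun i => a i none, fun j => Matrix.of fun i q => a i (some (j, q)),
    EventuallyEq.rfl⟩, hζ.sub (secondOrder_linEst hy _ _), fun i => ?_, fun j h1 h2 => ?_⟩
  · have := ha i none (by simp [s])
    simpa [hrepr, g] using this
  · ext i q
    have := ha i (some (j, q)) (by simp [s, h1, h2])
    simpa [hrepr, g, momMat] using this

theorem mse_congr {ζ Z Z' : Ω → Fin n → ℝ} (h : Z =ᵐ[P] Z') : mse P ζ Z = mse P ζ Z' :=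
  integral_congr_ae (h.mono fun ω hω => by simp only [hω])

theorem mse_self_eq_zero {Z Z' : Ω → Fin n → ℝ} (hZ : SecondOrder P Z) (hZ' : SecondOrder P Z')
    (h : mse P Z Z' ≤ 0) : Z =ᵐ[P] Z' := by
  have hint : ∀ i, Integrable (fun ω => (Z ω i - Z' ω i) ^ 2) P := fun i =>
    ((hZ i).sub (hZ' i)).integrable_sq
  have h0 : ∫ ω, ∑ i, (Z ω i - Z' ω i) ^ 2 ∂P = 0 :=
    le_antisymm h (integral_nonneg fun ω => Finset.sum_nonneg fun i _ => sq_nonneg _)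
  rw [integral_eq_zero_iff_of_nonneg (fun ω => Finset.sum_nonneg fun i _ => sq_nonneg _)
    (integrable_finsetSum _ fun i _ => hint i)] at h0
  filter_upwards [h0] with ω hω
  funext i
  have := (Finset.sum_eq_zero_iff_of_nonneg fun i _ => sq_nonneg (Z ω i - Z' ω i)).1 hω i
    (Finset.mem_univ i)
  exact sub_eq_zero.1 (pow_eq_zero_iff two_ne_zero |>.1 this)

/-- Pythagoras' theorem for the mean squared error. -/
theorem mse_eq_add_of_momMat_eq_zero {ζ Z Z' : Ω → Fin n → ℝ} (hζ : SecondOrder P ζ)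
    (hZ : SecondOrder P Z) (hZ' : SecondOrder P Z')
    (h : momMat P (fun ω => ζ ω - Z ω) (fun ω => Z ω - Z' ω) = 0) :
    mse P ζ Z' = mse P ζ Z + mse P Z Z' := by
  have i1 : ∀ i, Integrable (fun ω => (ζ ω i - Z ω i) ^ 2) P := fun i =>
    ((hζ i).sub (hZ i)).integrable_sq
  have i2 : ∀ i, Integrable (fun ω => (Z ω i - Z' ω i) ^ 2) P := fun i =>
    ((hZ i).sub (hZ' i)).integrable_sq
  have i3 : ∀ i, Integrable (fun ω => 2 * ((ζ ω i - Z ω i) * (Z ω i - Z' ω i))) P := fun i =>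
    ((hζ.sub hZ).integrable_mul (hZ.sub hZ') i i).const_mul 2
  have h3 : ∀ i, ∫ ω, 2 * ((ζ ω i - Z ω i) * (Z ω i - Z' ω i)) ∂P = 0 := fun i => by
    rw [integral_const_mul]
    have := congrFun (congrFun h i) i
    simp only [momMat, Matrix.of_apply, Pi.sub_apply, Matrix.zero_apply] at this
    rw [this, mul_zero]
  have e : ∀ ω, ∑ i, (ζ ω i - Z' ω i) ^ 2 = ∑ i, ((ζ ω i - Z ω i) ^ 2 + (Z ω i - Z' ω i) ^ 2
      + 2 * ((ζ ω i - Z ω i) * (Z ω i - Z' ω i))) := fun ω =>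
    Finset.sum_congr rfl fun i _ => by ring
  have i4 : ∀ i, Integrable (fun ω => (ζ ω i - Z ω i) ^ 2 + (Z ω i - Z' ω i) ^ 2
      + 2 * ((ζ ω i - Z ω i) * (Z ω i - Z' ω i))) P := fun i => ((i1 i).add (i2 i)).add (i3 i)
  simp only [mse, e]
  rw [integral_finsetSum _ fun i _ => i4 i,
    integral_finsetSum _ fun i _ => i1 i, integral_finsetSum _ fun i _ => i2 i,
    ← Finset.sum_add_distrib]
  refine Finset.sum_congr rfl fun i _ => ?_
  refine (integral_add ((i1 i).add (i2 i)) (i3 i)).trans ?_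
  rw [h3, add_zero]
  exact integral_add (i1 i) (i2 i)

/-- Orthogonality principle: a linear estimator with an orthogonal error is, up to null sets, the
unique least-squares linear estimator. -/
theorem isLSLinearEstimator_iff_ae_eq [IsFiniteMeasure P]
    (hy : ∀ j, 1 ≤ j → j ≤ L → SecondOrder P (y j)) {ζ Z : Ω → Fin n → ℝ}
    (hζ : SecondOrder P ζ) (hZ : IsAffineIn P y L Z) (hR : IsOrthTo P y L fun ω => ζ ω - Z ω)
    (Z' : Ω → Fin n → ℝ) : IsLSLinearEstimator P y L ζ Z' ↔ Z' =ᵐ[P] Z := by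
  -- The difference of two affine estimators is again affine in the observations, hence orthogonal
  -- to the error of `Z`.
  have pyth : ∀ W : Ω → Fin n → ℝ, IsAffineIn P y L W → mse P ζ W = mse P ζ Z + mse P Z W :=
    fun W hW => mse_eq_add_of_momMat_eq_zero hζ (hZ.secondOrder hy) (hW.secondOrder hy)
      (hR.momMat_affine hy (hZ.sub hW))
  constructor
  · rintro ⟨hlin, hopt⟩
    have hlin' : IsAffineIn P y L Z' := hlin
    obtain ⟨c, K, hcK⟩ := hZ
    have h1 := hopt c K
    rw [← mse_congr hcK, pyth Z' hlin'] at h1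
    exact (mse_self_eq_zero ((secondOrder_linEst hy c K).congr hcK.symm)
      (hlin'.secondOrder hy) (by linarith)).symm
  · intro h
    refine ⟨hZ.congr h.symm, fun c K => ?_⟩
    rw [mse_congr h, pyth _ ⟨c, K, EventuallyEq.rfl⟩]
    have : 0 ≤ mse P Z (linEst y L c K) :=
      integral_nonneg fun ω => Finset.sum_nonneg fun i _ => sq_nonneg _
    linarith

/-- By uniqueness, any minimizer agrees almost surely with the projection, and so inherits its
orthogonal error. -/
theorem IsLSLinearEstimator.isOrthTo [IsFiniteMeasure P]
    (hy : ∀ j, 1 ≤ j → j ≤ L → SecondOrder P (y j)) {ζ Z : Ω → Fin n → ℝ}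
    (hζ : SecondOrder P ζ) (h : IsLSLinearEstimator P y L ζ Z) :
    IsOrthTo P y L fun ω => ζ ω - Z ω := by
  obtain ⟨W, hW, hR⟩ := exists_affine_isOrthTo hy hζ
  have := (isLSLinearEstimator_iff_ae_eq hy hζ hW hR Z).1 h
  refine hR.congr ?_
  filter_upwards [this] with ω hω
  rw [hω]

/-- Projections exist at each time whether or not the innovation covariances are invertible. The
predictor chosen at time 0 is arbitrary. -/
theorem exists_isInnovation [IsFiniteMeasure P] (hy : ∀ j, 1 ≤ j → SecondOrder P (y j)) :
    ∃ η, IsInnovation P y η := by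
  have h : ∀ k, ∃ Z : Ω → Fin m → ℝ, 1 ≤ k → IsLSLinearEstimator P y (k - 1) (y k) Z := by
    intro k
    by_cases hk : 1 ≤ k
    · obtain ⟨W, hW, hR⟩ := exists_affine_isOrthTo (L := k - 1) (fun j h1 _ => hy j h1) (hy k hk)
      exact ⟨W, fun _ => (isLSLinearEstimator_iff_ae_eq (fun j h1 _ => hy j h1) (hy k hk)
        hW hR W).2 EventuallyEq.rfl⟩
    · exact ⟨0, fun h => absurd h hk⟩
  choose Z hZ using h
  refine ⟨fun k ω => y k ω - Z k ω, fun k hk => ?_⟩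
  simpa using hZ k hk

end LeastSquares

end DeceptionFilter

namespace DeceptionFilter

/-! ### Moments of products of independent factors. -/

section Independence

variable {Ω : Type*} {m₁ m₂ : MeasurableSpace Ω} [mΩ : MeasurableSpace Ω] {P : Measure Ω}
  {n m : ℕ}

theorem integral_mul_of_indep (h : Indep m₁ m₂ P) (h₁ : m₁ ≤ mΩ) (h₂ : m₂ ≤ mΩ) {f g : Ω → ℝ}
    (hf : Measurable[m₁] f) (hg : Measurable[m₂] g) :
    ∫ ω, f ω * g ω ∂P = (∫ ω, f ω ∂P) * ∫ ω, g ω ∂P := by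
  have hi : IndepFun f g P :=
    (IndepFun_iff_Indep f g P).2 (indep_of_indep_of_le_left
      (indep_of_indep_of_le_right h hg.comap_le) hf.comap_le)
  exact hi.integral_fun_mul_eq_mul_integral (hf.mono h₁ le_rfl).aestronglyMeasurable
    (hg.mono h₂ le_rfl).aestronglyMeasurable

/-- The expectation of the product factors, so it suffices that one of the two vectors has mean
zero. The product rule needs measurability and independence, not integrability. -/
theorem momMat_eq_zero_of_indep (h : Indep m₁ m₂ P) (h₁ : m₁ ≤ mΩ) (h₂ : m₂ ≤ mΩ)
    {X : Ω → Fin n → ℝ} {Y : Ω → Fin m → ℝ} (hX : Measurable[m₁] X) (hY : Measurable[m₂] Y)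
    (h0 : ZeroMean P Y) : momMat P X Y = 0 := by
  ext i j
  simp only [momMat, Matrix.of_apply, Matrix.zero_apply]
  refine (integral_mul_of_indep h h₁ h₂ ((measurable_pi_apply i).comp hX)
    ((measurable_pi_apply j).comp hY)).trans ?_
  exact mul_eq_zero_of_right _ (h0 j)

/-- This extracts Bernoulli multipliers: both scalars come from one σ-algebra and both vectors from
the other, so the scalars may be dependent on each other, or equal. -/
theorem momMat_smul_smul_of_indep (h : Indep m₁ m₂ P) (h₁ : m₁ ≤ mΩ) (h₂ : m₂ ≤ mΩ)
    {f g : Ω → ℝ} {X : Ω → Fin n → ℝ} {Y : Ω → Fin m → ℝ} (hf : Measurable[m₁] f)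
    (hg : Measurable[m₁] g) (hX : Measurable[m₂] X) (hY : Measurable[m₂] Y) :
    momMat P (fun ω => f ω • X ω) (fun ω => g ω • Y ω) =
      (∫ ω, f ω * g ω ∂P) • momMat P X Y := by
  ext i j
  have hXY : Measurable[m₂] fun ω => X ω i * Y ω j :=
    ((measurable_pi_apply i).comp hX).mul ((measurable_pi_apply j).comp hY)
  simp only [momMat, Matrix.of_apply, Matrix.smul_apply, Pi.smul_apply, smul_eq_mul]
  refine Eq.trans ?_ (integral_mul_of_indep h h₁ h₂ (hf.mul hg) hXY)
  exact integral_congr_ae (Eventually.of_forall fun ω => by ring)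

theorem integral_smul_of_indep (h : Indep m₁ m₂ P) (h₁ : m₁ ≤ mΩ) (h₂ : m₂ ≤ mΩ)
    {f : Ω → ℝ} {X : Ω → Fin n → ℝ} (hf : Measurable[m₁] f) (hX : Measurable[m₂] X) (i : Fin n) :
    ∫ ω, (f ω • X ω) i ∂P = (∫ ω, f ω ∂P) * ∫ ω, X ω i ∂P :=
  integral_mul_of_indep h h₁ h₂ hf ((measurable_pi_apply i).comp hX)

theorem norm_le_one_of_bernoulli {f : Ω → ℝ} (h : ∀ᵐ ω ∂P, f ω = 0 ∨ f ω = 1) :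
    ∀ᵐ ω ∂P, ‖f ω‖ ≤ 1 := by
  filter_upwards [h] with ω hω
  rcases hω with h | h <;> simp [h]

theorem norm_one_sub_le_one_of_bernoulli {f : Ω → ℝ} (h : ∀ᵐ ω ∂P, f ω = 0 ∨ f ω = 1) :
    ∀ᵐ ω ∂P, ‖1 - f ω‖ ≤ 1 := by
  filter_upwards [h] with ω hω
  rcases hω with h | h <;> simp [h]

end Independence

namespace Model

/-! ### σ-algebras of groups of processes. -/

section SigmaOf

variable {Ω : Type*} {nx nz p : ℕ} (M : Model Ω nx nz p)

/-- The σ-algebra generated by a subfamily of the five processes. -/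
abbrev sigmaOf (S : Set Proc) : MeasurableSpace Ω := ⨆ i ∈ S, M.sigmaAlg i

variable {S : Set Proc} {k : ℕ}

theorem measurable_x (hS : Proc.signal ∈ S) (hk : 1 ≤ k) : Measurable[M.sigmaOf S] (M.x k) :=
  (comap_measurable (M.x k)).mono ((le_iSup (fun k : Set.Ici (1 : ℕ) =>
    MeasurableSpace.comap (M.x k) inferInstance) ⟨k, hk⟩).trans
      (le_iSup₂ (f := fun i (_ : i ∈ S) => M.sigmaAlg i) _ hS)) le_rfl

theorem measurable_gam (hS : Proc.gam ∈ S) (hk : 1 ≤ k) : Measurable[M.sigmaOf S] (M.gam k) :=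
  (comap_measurable (M.gam k)).mono ((le_iSup (fun k : Set.Ici (1 : ℕ) =>
    MeasurableSpace.comap (M.gam k) inferInstance) ⟨k, hk⟩).trans
      (le_iSup₂ (f := fun i (_ : i ∈ S) => M.sigmaAlg i) _ hS)) le_rfl

theorem measurable_v (hS : Proc.noise ∈ S) (hk : 1 ≤ k) : Measurable[M.sigmaOf S] (M.v k) :=
  (comap_measurable (M.v k)).mono ((le_iSup (fun k : Set.Ici (1 : ℕ) =>
    MeasurableSpace.comap (M.v k) inferInstance) ⟨k, hk⟩).trans
      (le_iSup₂ (f := fun i (_ : i ∈ S) => M.sigmaAlg i) _ hS)) le_rfl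

theorem measurable_w (hS : Proc.attack ∈ S) (hk : 1 ≤ k) : Measurable[M.sigmaOf S] (M.w k) :=
  (comap_measurable (M.w k)).mono ((le_iSup (fun k : Set.Ici (1 : ℕ) =>
    MeasurableSpace.comap (M.w k) inferInstance) ⟨k, hk⟩).trans
      (le_iSup₂ (f := fun i (_ : i ∈ S) => M.sigmaAlg i) _ hS)) le_rfl

theorem measurable_lam (hS : Proc.lam ∈ S) (hk : 1 ≤ k) : Measurable[M.sigmaOf S] (M.lam k) :=
  (comap_measurable (M.lam k)).mono ((le_iSup (fun k : Set.Ici (1 : ℕ) =>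
    MeasurableSpace.comap (M.lam k) inferInstance) ⟨k, hk⟩).trans
      (le_iSup₂ (f := fun i (_ : i ∈ S) => M.sigmaAlg i) _ hS)) le_rfl

/-- The linearized signal part `H_k x_k + C_k` of the measurements. -/
noncomputable def linSignal (k : ℕ) (ω : Ω) : Fin nz → ℝ := M.H k *ᵥ M.x k ω + M.C k

theorem measurable_linSignal (hS : Proc.signal ∈ S) (hk : 1 ≤ k) :
    Measurable[M.sigmaOf S] (M.linSignal k) :=
  (show Measurable fun x : Fin nx → ℝ => M.H k *ᵥ x + M.C k by fun_prop).comp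
    (M.measurable_x hS hk)

theorem measurable_smul_linSignal (hS : Proc.signal ∈ S) (hS' : Proc.gam ∈ S) (hk : 1 ≤ k) :
    Measurable[M.sigmaOf S] fun ω => M.gam k ω • M.linSignal k ω :=
  (M.measurable_gam hS' hk).smul (M.measurable_linSignal hS hk)

theorem measurable_z (hS : Proc.signal ∈ S) (hS' : Proc.gam ∈ S) (hS'' : Proc.noise ∈ S)
    (hk : 1 ≤ k) : Measurable[M.sigmaOf S] (M.z k) :=
  (M.measurable_smul_linSignal hS hS' hk).add (M.measurable_v hS'' hk)

end SigmaOf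

/-! ### First and second moments of the signal, the noise and the observations. -/

namespace Hyp

variable {Ω : Type*} {nx nz p : ℕ} [mΩ : MeasurableSpace Ω] {P : Measure Ω}
  {M : Model Ω nx nz p}

theorem sigmaAlg_le (hM : M.Hyp P) (i : Proc) : M.sigmaAlg i ≤ mΩ := by
  cases i
  · exact iSup_le fun k => (hM.meas_x k k.2).comap_le
  · exact iSup_le fun k => (hM.meas_gam k k.2).comap_le
  · exact iSup_le fun k => (hM.meas_v k).comap_le
  · exact iSup_le fun k => (hM.meas_w k k.2).comap_le
  · exact iSup_le fun k => (hM.meas_lam k k.2).comap_le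

theorem sigmaOf_le (hM : M.Hyp P) (S : Set Proc) : M.sigmaOf S ≤ mΩ :=
  iSup₂_le fun i _ => hM.sigmaAlg_le i

/-- The one place where the mutual independence of the five processes enters. Later uses split them
into one process against some or all of the others. -/
theorem indep_sigmaOf (hM : M.Hyp P) {S T : Set Proc} (h : Disjoint S T) :
    Indep (M.sigmaOf S) (M.sigmaOf T) P :=
  indep_iSup_of_disjoint hM.sigmaAlg_le hM.mutual_indep h

variable {k s : ℕ}

theorem smul_w_secondOrder (hM : M.Hyp P) (hk : 1 ≤ k) :
    SecondOrder P fun ω => M.lam k ω • M.w k ω :=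
  (hM.w_secondOrder k hk).smul_of_bound (hM.meas_lam k hk).aestronglyMeasurable 1
    (norm_le_one_of_bernoulli (hM.lam_bernoulli k hk))

theorem integral_gam_mul_self (hM : M.Hyp P) (hk : 1 ≤ k) :
    ∫ ω, M.gam k ω * M.gam k ω ∂P = M.gamBar k := by
  rw [← hM.gam_mean k hk]
  refine integral_congr_ae ?_
  filter_upwards [hM.gam_bernoulli k hk] with ω hω
  rcases hω with h | h <;> simp [h]

theorem integral_lam_mul_self (hM : M.Hyp P) (hk : 1 ≤ k) :
    ∫ ω, M.lam k ω * M.lam k ω ∂P = M.lamBar k := by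
  rw [← hM.lam_mean k hk]
  refine integral_congr_ae ?_
  filter_upwards [hM.lam_bernoulli k hk] with ω hω
  rcases hω with h | h <;> simp [h]

theorem isUnit_det_E (hM : M.Hyp P) (k : ℕ) : IsUnit (M.E k).det := by
  induction k with
  | zero => simp [E]
  | succ k ih =>
    rw [E, Matrix.det_mul]
    exact (hM.D_nonsingular k).mul ih

theorem momMat_z_w (hM : M.Hyp P) (hk : 1 ≤ k) (hs : 1 ≤ s) : momMat P (M.z k) (M.w s) = 0 :=
  momMat_eq_zero_of_indep
    (hM.indep_sigmaOf (S := {Proc.attack}ᶜ) (T := {Proc.attack}) disjoint_compl_left)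
    (hM.sigmaOf_le _) (hM.sigmaOf_le _) (M.measurable_z (by simp) (by simp) (by simp) hk)
    (M.measurable_w (by simp) hs) (hM.w_zeroMean s hs)

theorem v_secondOrder (hM : M.Hyp P) (k : ℕ) : SecondOrder P (M.v k) := by
  induction k with
  | zero => exact hM.v0_secondOrder
  | succ k ih => exact ((ih.mulVec _).add (hM.u_secondOrder k)).congr (EventuallyEq.symm (hM.markov k))

theorem integral_gam_mul_gam (hM : M.Hyp P) (hk : 1 ≤ k) (hs : 1 ≤ s) (hks : k ≠ s) :
    ∫ ω, M.gam k ω * M.gam s ω ∂P = M.gamBar k * M.gamBar s := by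
  have h : IndepFun (M.gam k) (M.gam s) P :=
    hM.gam_indep.indepFun (i := ⟨k, hk⟩) (j := ⟨s, hs⟩) (fun h => hks (congrArg Subtype.val h))
  rw [h.integral_fun_mul_eq_mul_integral (hM.meas_gam k hk).aestronglyMeasurable
    (hM.meas_gam s hs).aestronglyMeasurable, hM.gam_mean k hk, hM.gam_mean s hs]

variable [IsProbabilityMeasure P]

theorem v_zeroMean (hM : M.Hyp P) (k : ℕ) : ZeroMean P (M.v k) := by
  induction k with
  | zero => exact hM.v0_zeroMean
  | succ k ih =>
    exact (((ih.mulVec (M.D k) (hM.v_secondOrder k)).add ((hM.v_secondOrder k).mulVec _)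
      (hM.u_secondOrder k) (hM.u_zeroMean k))).congr (EventuallyEq.symm (hM.markov k))

theorem linSignal_secondOrder (hM : M.Hyp P) (hk : 1 ≤ k) : SecondOrder P (M.linSignal k) :=
  ((hM.signal_secondOrder k hk).mulVec _).add (SecondOrder.const _)

theorem smul_linSignal_secondOrder (hM : M.Hyp P) (hk : 1 ≤ k) :
    SecondOrder P fun ω => M.gam k ω • M.linSignal k ω :=
  (hM.linSignal_secondOrder hk).smul_of_bound (hM.meas_gam k hk).aestronglyMeasurable 1
    (norm_le_one_of_bernoulli (hM.gam_bernoulli k hk))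

theorem z_secondOrder (hM : M.Hyp P) (hk : 1 ≤ k) : SecondOrder P (M.z k) :=
  (hM.smul_linSignal_secondOrder hk).add (hM.v_secondOrder k)

theorem smul_z_secondOrder (hM : M.Hyp P) (hk : 1 ≤ k) :
    SecondOrder P fun ω => (1 - M.lam k ω) • M.z k ω :=
  (hM.z_secondOrder hk).smul_of_bound
    (measurable_const.sub (hM.meas_lam k hk)).aestronglyMeasurable 1
    (norm_one_sub_le_one_of_bernoulli (hM.lam_bernoulli k hk))

theorem y_secondOrder (hM : M.Hyp P) (hk : 1 ≤ k) : SecondOrder P (M.y k) :=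
  (hM.smul_z_secondOrder hk).add (hM.smul_w_secondOrder hk)

theorem integral_one_sub_lam (hM : M.Hyp P) (hk : 1 ≤ k) :
    ∫ ω, (1 - M.lam k ω) ∂P = 1 - M.lamBar k := by
  have hint : Integrable (M.lam k) P :=
    (memLp_top_of_bound (hM.meas_lam k hk).aestronglyMeasurable 1
      (norm_le_one_of_bernoulli (hM.lam_bernoulli k hk))).integrable le_top
  rw [integral_sub (integrable_const _) hint, hM.lam_mean k hk]
  simp

theorem integral_one_sub_lam_mul (hM : M.Hyp P) (hk : 1 ≤ k) (hs : 1 ≤ s) (hks : k ≠ s) :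
    ∫ ω, (1 - M.lam k ω) * (1 - M.lam s ω) ∂P = (1 - M.lamBar k) * (1 - M.lamBar s) := by
  have h : IndepFun (M.lam k) (M.lam s) P :=
    hM.lam_indep.indepFun (i := ⟨k, hk⟩) (j := ⟨s, hs⟩) (fun h => hks (congrArg Subtype.val h))
  have h' : IndepFun (fun ω => 1 - M.lam k ω) (fun ω => 1 - M.lam s ω) P :=
    h.comp (φ := fun t => 1 - t) (ψ := fun t => 1 - t) (by fun_prop) (by fun_prop)
  rw [h'.integral_fun_mul_eq_mul_integral
    (measurable_const.sub (hM.meas_lam k hk)).aestronglyMeasurable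
    (measurable_const.sub (hM.meas_lam s hs)).aestronglyMeasurable,
    hM.integral_one_sub_lam hk, hM.integral_one_sub_lam hs]

theorem integral_one_sub_lam_mul_self (hM : M.Hyp P) (hk : 1 ≤ k) :
    ∫ ω, (1 - M.lam k ω) * (1 - M.lam k ω) ∂P = 1 - M.lamBar k := by
  rw [← hM.integral_one_sub_lam hk]
  refine integral_congr_ae ?_
  filter_upwards [hM.lam_bernoulli k hk] with ω hω
  rcases hω with h | h <;> simp [h]

/-- By the Markov recursion, v_k is built from v_0 and u_0, …, u_{k-1}; the first is independent of
u_s, and the others are uncorrelated with it because their indices are below k ≤ s. -/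
theorem momMat_v_u (hM : M.Hyp P) {k s : ℕ} (h : k ≤ s) : momMat P (M.v k) (M.u s) = 0 := by
  induction k with
  | zero =>
    refine momMat_eq_zero_of_indep hM.u_indep.symm (hM.meas_v 0).comap_le
      (iSup_le fun j => (hM.meas_u j).comap_le) (comap_measurable _)
      ((comap_measurable (M.u s)).mono ?_ le_rfl) (hM.u_zeroMean s)
    exact le_iSup (fun k => MeasurableSpace.comap (M.u k) inferInstance) s
  | succ k ih =>
    rw [momMat_congr (hM.markov k) (EventuallyEq.refl _ (M.u s)),
      momMat_add_left ((hM.v_secondOrder k).mulVec _) (hM.u_secondOrder k) (hM.u_secondOrder s),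
      momMat_mulVec_left _ (hM.v_secondOrder k) (hM.u_secondOrder s), ih (by omega),
      ← covMat_eq_momMat (hM.u_secondOrder k) (hM.u_secondOrder s) (hM.u_zeroMean k),
      hM.u_white k s (by omega), Matrix.mul_zero, add_zero]

theorem momMat_v_self (hM : M.Hyp P) (k : ℕ) : momMat P (M.v k) (M.v k) = M.SigmaV k := by
  induction k with
  | zero =>
    rw [← covMat_eq_momMat hM.v0_secondOrder hM.v0_secondOrder hM.v0_zeroMean, hM.v0_cov]
    rfl
  | succ k ih =>
    have hv := hM.v_secondOrder k
    have hu := hM.u_secondOrder k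
    rw [momMat_congr (hM.markov k) (hM.markov k),
      momMat_add_left (hv.mulVec _) hu ((hv.mulVec _).add hu),
      momMat_add_right (hv.mulVec _) (hv.mulVec _) hu, momMat_add_right hu (hv.mulVec _) hu,
      momMat_mulVec_left _ hv (hv.mulVec _), momMat_mulVec_left _ hv hu,
      momMat_mulVec_right _ hv hv, momMat_mulVec_right _ hu hv, ← momMat_transpose (M.v k) (M.u k),
      hM.momMat_v_u le_rfl, ih,
      ← covMat_eq_momMat (hM.u_secondOrder k) (hM.u_secondOrder k) (hM.u_zeroMean k), hM.u_cov]
    simp [SigmaV, Matrix.mul_assoc]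

/-- Moving the later time forward only multiplies by D_k on the left, since the fresh u_k is
uncorrelated with v_s; this builds up E_k. At k = s, the inverse inside F_s cancels E_s and leaves
Σ^v_s, which is symmetric as a second-moment matrix. -/
theorem momMat_v_v (hM : M.Hyp P) (h : s ≤ k) :
    momMat P (M.v k) (M.v s) = M.E k * (M.F s)ᵀ := by
  induction k, h using Nat.le_induction with
  | base =>
    rw [F, Matrix.transpose_mul, Matrix.transpose_transpose,
      Matrix.mul_nonsing_inv_cancel_left _ _ (hM.isUnit_det_E s), ← hM.momMat_v_self,
      momMat_transpose]
  | succ k hk ih =>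
    rw [momMat_congr (hM.markov k) (EventuallyEq.refl _ (M.v s)),
      momMat_add_left ((hM.v_secondOrder k).mulVec _) (hM.u_secondOrder k) (hM.v_secondOrder s),
      momMat_mulVec_left _ (hM.v_secondOrder k) (hM.v_secondOrder s), ih,
      ← momMat_transpose (M.v s) (M.u k), hM.momMat_v_u hk, Matrix.transpose_zero, add_zero, E,
      Matrix.mul_assoc]

theorem momMat_x_x (hM : M.Hyp P) (hs : 1 ≤ s) (h : s ≤ k) :
    momMat P (M.x k) (M.x s) = M.A k * (M.B s)ᵀ := by
  rw [← hM.signal_cov k s hs h, covMat_eq_momMat (hM.signal_secondOrder k (hs.trans h))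
    (hM.signal_secondOrder s hs) (hM.signal_zeroMean k (hs.trans h))]

theorem momMat_x_linSignal (hM : M.Hyp P) (hs : 1 ≤ s) (h : s ≤ k) :
    momMat P (M.x k) (M.linSignal s) = M.A k * (M.B s)ᵀ * (M.H s)ᵀ := by
  have sk := hM.signal_secondOrder k (hs.trans h)
  have ss := hM.signal_secondOrder s hs
  refine (momMat_add_right sk (ss.mulVec _) (SecondOrder.const _)).trans ?_
  rw [momMat_mulVec_right _ sk ss, momMat_const_right (hM.signal_zeroMean k (hs.trans h)),
    hM.momMat_x_x hs h, add_zero]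

theorem momMat_linSignal (hM : M.Hyp P) (hs : 1 ≤ s) (h : s ≤ k) :
    momMat P (M.linSignal k) (M.linSignal s) =
      M.H k * M.A k * (M.B s)ᵀ * (M.H s)ᵀ + Matrix.vecMulVec (M.C k) (M.C s) := by
  have sk := hM.signal_secondOrder k (hs.trans h)
  have ss := hM.signal_secondOrder s hs
  refine (momMat_add_left (sk.mulVec _) (SecondOrder.const _)
    (hM.linSignal_secondOrder hs)).trans ?_
  rw [momMat_mulVec_left _ sk (hM.linSignal_secondOrder hs), hM.momMat_x_linSignal hs h]
  have : momMat P (fun _ => M.C k) (M.linSignal s) = Matrix.vecMulVec (M.C k) (M.C s) := by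
    refine (momMat_add_right (SecondOrder.const _) (ss.mulVec _) (SecondOrder.const _)).trans ?_
    rw [momMat_const_left ((hM.signal_zeroMean s hs).mulVec _ ss), momMat_const_const, zero_add]
  rw [this]
  simp only [Matrix.mul_assoc]

theorem momMat_smul_linSignal_v (hM : M.Hyp P) (hk : 1 ≤ k) (hs : 1 ≤ s) :
    momMat P (fun ω => M.gam k ω • M.linSignal k ω) (M.v s) = 0 :=
  momMat_eq_zero_of_indep
    (hM.indep_sigmaOf (S := {Proc.noise}ᶜ) (T := {Proc.noise}) disjoint_compl_left)
    (hM.sigmaOf_le _) (hM.sigmaOf_le _) (M.measurable_smul_linSignal (by simp) (by simp) hk)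
    (M.measurable_v (by simp) hs) (hM.v_zeroMean s)

/-- The mean of γ_k γ_s is left unevaluated because it depends on the case: γ̄_k γ̄_s at distinct
times by independence, but γ̄_k when s = k since γ² = γ. -/
theorem momMat_z_z (hM : M.Hyp P) (hs : 1 ≤ s) (h : s ≤ k) :
    momMat P (M.z k) (M.z s) = (∫ ω, M.gam k ω * M.gam s ω ∂P) •
      (M.H k * M.A k * (M.B s)ᵀ * (M.H s)ᵀ + Matrix.vecMulVec (M.C k) (M.C s))
        + M.E k * (M.F s)ᵀ := by
  have hk := hs.trans h
  have ak := hM.smul_linSignal_secondOrder hk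
  have as := hM.smul_linSignal_secondOrder hs
  have vk := hM.v_secondOrder k
  have vs := hM.v_secondOrder s
  refine (momMat_add_left ak vk (as.add vs)).trans ?_
  rw [momMat_add_right ak as vs, momMat_add_right vk as vs, hM.momMat_smul_linSignal_v hk hs,
    ← momMat_transpose _ (M.v k), hM.momMat_smul_linSignal_v hs hk, hM.momMat_v_v h,
    momMat_smul_smul_of_indep
      (hM.indep_sigmaOf (S := {Proc.gam}) (T := {Proc.gam}ᶜ) disjoint_compl_right)
      (hM.sigmaOf_le _) (hM.sigmaOf_le _) (M.measurable_gam (by simp) hk)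
      (M.measurable_gam (by simp) hs) (M.measurable_linSignal (by simp) hk)
      (M.measurable_linSignal (by simp) hs), hM.momMat_linSignal hs h]
  simp

theorem momMat_z_self (hM : M.Hyp P) (hk : 1 ≤ k) :
    momMat P (M.z k) (M.z k) = M.gamBar k •
      (M.H k * M.A k * (M.B k)ᵀ * (M.H k)ᵀ + Matrix.vecMulVec (M.C k) (M.C k))
        + M.E k * (M.F k)ᵀ := by
  rw [hM.momMat_z_z hk le_rfl, hM.integral_gam_mul_self hk]

/-- Cross terms between z and w vanish because w has mean zero and is independent of z. The λ means
stay unevaluated so that equal and distinct times are both covered. -/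
theorem momMat_y_y (hM : M.Hyp P) (hk : 1 ≤ k) (hs : 1 ≤ s) :
    momMat P (M.y k) (M.y s) =
      (∫ ω, (1 - M.lam k ω) * (1 - M.lam s ω) ∂P) • momMat P (M.z k) (M.z s) +
        (∫ ω, M.lam k ω * M.lam s ω ∂P) • momMat P (M.w k) (M.w s) := by
  have hi := hM.indep_sigmaOf (S := {Proc.lam}) (T := {Proc.lam}ᶜ) disjoint_compl_right
  have l1 := hM.sigmaOf_le {Proc.lam}
  have l2 := hM.sigmaOf_le {Proc.lam}ᶜ
  have mk := M.measurable_lam (S := {Proc.lam}) (by simp) hk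
  have ms := M.measurable_lam (S := {Proc.lam}) (by simp) hs
  have mk' := mk.const_sub 1
  have ms' := ms.const_sub 1
  have zk := M.measurable_z (S := {Proc.lam}ᶜ) (by simp) (by simp) (by simp) hk
  have zs := M.measurable_z (S := {Proc.lam}ᶜ) (by simp) (by simp) (by simp) hs
  have wk := M.measurable_w (S := {Proc.lam}ᶜ) (by simp) hk
  have ws := M.measurable_w (S := {Proc.lam}ᶜ) (by simp) hs
  have szk := hM.smul_z_secondOrder hk
  have szs := hM.smul_z_secondOrder hs
  have swk := hM.smul_w_secondOrder hk
  have sws := hM.smul_w_secondOrder hs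
  refine (momMat_add_left szk swk (szs.add sws)).trans ?_
  rw [momMat_add_right szk szs sws, momMat_add_right swk szs sws,
    momMat_smul_smul_of_indep hi l1 l2 mk' ms' zk zs,
    momMat_smul_smul_of_indep hi l1 l2 mk' ms zk ws,
    momMat_smul_smul_of_indep hi l1 l2 mk ms' wk zs,
    momMat_smul_smul_of_indep hi l1 l2 mk ms wk ws, hM.momMat_z_w hk hs,
    ← momMat_transpose (M.z s) (M.w k), hM.momMat_z_w hs hk]
  simp

theorem momMat_y_self (hM : M.Hyp P) (hk : 1 ≤ k) :
    momMat P (M.y k) (M.y k) =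
      (1 - M.lamBar k) • momMat P (M.z k) (M.z k) + M.lamBar k • M.SigmaW k := by
  rw [hM.momMat_y_y hk hk, hM.integral_one_sub_lam_mul_self hk, hM.integral_lam_mul_self hk,
    ← covMat_eq_momMat (hM.w_secondOrder k hk) (hM.w_secondOrder k hk) (hM.w_zeroMean k hk),
    hM.w_cov k hk]

/-- The mean of the observation `y_k`. -/
noncomputable def _root_.DeceptionFilter.Model.yMean (M : Model Ω nx nz p) (k : ℕ) :
    Fin nz → ℝ := (1 - M.lamBar k) • M.gamBar k • M.C k

theorem integral_z (hM : M.Hyp P) (hk : 1 ≤ k) (i : Fin nz) :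
    ∫ ω, M.z k ω i ∂P = M.gamBar k * M.C k i := by
  have h1 : ∫ ω, M.linSignal k ω i ∂P = M.C k i := by
    simp only [linSignal, Pi.add_apply]
    rw [integral_add (((hM.signal_secondOrder k hk).mulVec _).integrable i) (integrable_const _),
      (hM.signal_zeroMean k hk).mulVec _ (hM.signal_secondOrder k hk) i]
    simp
  refine (integral_add ((hM.smul_linSignal_secondOrder hk).integrable i)
    ((hM.v_secondOrder k).integrable i)).trans ?_
  rw [hM.v_zeroMean k i, integral_smul_of_indep
    (hM.indep_sigmaOf (S := {Proc.gam}) (T := {Proc.gam}ᶜ) disjoint_compl_right)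
    (hM.sigmaOf_le _) (hM.sigmaOf_le _) (M.measurable_gam (by simp) hk)
    (M.measurable_linSignal (by simp) hk), hM.gam_mean k hk, h1, add_zero]

theorem y_sub_yMean_zeroMean (hM : M.Hyp P) (hk : 1 ≤ k) :
    ZeroMean P fun ω => M.y k ω - M.yMean k := by
  intro i
  have hi := hM.indep_sigmaOf (S := {Proc.lam}) (T := {Proc.lam}ᶜ) disjoint_compl_right
  have l1 := hM.sigmaOf_le {Proc.lam}
  have l2 := hM.sigmaOf_le {Proc.lam}ᶜ
  have mk := M.measurable_lam (S := {Proc.lam}) (by simp) hk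
  have hy : ∫ ω, M.y k ω i ∂P = M.yMean k i := by
    refine (integral_add ((hM.smul_z_secondOrder hk).integrable i)
      ((hM.smul_w_secondOrder hk).integrable i)).trans ?_
    rw [integral_smul_of_indep hi l1 l2 (mk.const_sub 1)
        (M.measurable_z (by simp) (by simp) (by simp) hk),
      integral_smul_of_indep hi l1 l2 mk (M.measurable_w (by simp) hk),
      hM.w_zeroMean k hk i, hM.integral_one_sub_lam hk, hM.integral_z hk, mul_zero, add_zero]
    rfl
  simp only [Pi.sub_apply]
  rw [integral_sub ((hM.y_secondOrder hk).integrable i) (integrable_const _), hy]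
  simp

/-- Factorization of the covariances of the observations. -/
theorem momMat_y_sub_yMean (hM : M.Hyp P) (hs : 1 ≤ s) (h : s < k) :
    momMat P (fun ω => M.y k ω - M.yMean k) (M.y s) = (1 - M.lamBar s) •
      (((1 - M.lamBar k) • M.Del .x k) * (M.Gam .x s)ᵀ +
        ((1 - M.lamBar k) • M.Del .v k) * (M.Gam .v s)ᵀ) := by
  have hk : 1 ≤ k := by omega
  -- Write y_s as its centred part plus its mean; a constant is orthogonal to the centred part. The
  -- resulting product of means cancels the C_k C_sᵀ term below, which is where s < k matters.
  have hc : momMat P (fun _ => M.yMean k) (M.y s) = Matrix.vecMulVec (M.yMean k) (M.yMean s) := by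
    have h1 := momMat_add_right (P := P) (SecondOrder.const (M.yMean k))
      ((hM.y_secondOrder hs).sub (SecondOrder.const (M.yMean s)))
      (SecondOrder.const (M.yMean s))
    rw [momMat_const_left (hM.y_sub_yMean_zeroMean hs), momMat_const_const, zero_add] at h1
    simpa using h1
  rw [momMat_sub_left (hM.y_secondOrder hk) (SecondOrder.const _) (hM.y_secondOrder hs), hc,
    hM.momMat_y_y hk hs, hM.momMat_z_z hs h.le, hM.integral_gam_mul_gam hk hs h.ne',
    hM.integral_one_sub_lam_mul hk hs h.ne',
    ← covMat_eq_momMat (hM.w_secondOrder k hk) (hM.w_secondOrder s hs) (hM.w_zeroMean k hk),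
    hM.w_white k s hk hs h.ne', yMean, yMean]
  simp only [Del, Gam, Matrix.transpose_smul, Matrix.transpose_mul, Matrix.smul_mul,
    Matrix.mul_smul, Matrix.mul_assoc, Matrix.smul_vecMulVec, Matrix.vecMulVec_smul, smul_zero,
    add_zero]
  module

/-- Factorization of the covariances of signal and observations. -/
theorem momMat_x_y (hM : M.Hyp P) (hs : 1 ≤ s) (h : s ≤ k) :
    momMat P (M.x k) (M.y s) = (1 - M.lamBar s) • (M.A k * (M.Gam .x s)ᵀ) := by
  have hk := hs.trans h
  have sx := hM.signal_secondOrder k hk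
  -- Pulls a multiplier independent of signal and vector out of the moment; the signal itself gets
  -- the constant multiplier 1.
  have key : ∀ {S : Set Proc} {q : ℕ} {f : Ω → ℝ} {Y : Ω → Fin q → ℝ},
      Proc.signal ∈ Sᶜ → Measurable[M.sigmaOf S] f → Measurable[M.sigmaOf Sᶜ] Y →
      momMat P (M.x k) (fun ω => f ω • Y ω) = (∫ ω, f ω ∂P) • momMat P (M.x k) Y := by
    intro S q f Y hS hf hY
    have := momMat_smul_smul_of_indep (hM.indep_sigmaOf (S := S) (T := Sᶜ) disjoint_compl_right)
      (hM.sigmaOf_le _) (hM.sigmaOf_le _) (f := fun _ => 1) measurable_const hf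
      (M.measurable_x hS hk) hY
    simpa using this
  have hz : momMat P (M.x k) (M.z s) = M.A k * (M.Gam .x s)ᵀ := by
    refine (momMat_add_right sx (hM.smul_linSignal_secondOrder hs) (hM.v_secondOrder s)).trans ?_
    rw [key (S := {Proc.gam}) (by simp) (M.measurable_gam (by simp) hs)
        (M.measurable_linSignal (by simp) hs), hM.gam_mean s hs, hM.momMat_x_linSignal hs h,
      momMat_eq_zero_of_indep
        (hM.indep_sigmaOf (S := {Proc.signal}) (T := {Proc.signal}ᶜ) disjoint_compl_right)
        (hM.sigmaOf_le _) (hM.sigmaOf_le _) (M.measurable_x (by simp) hk)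
        (M.measurable_v (by simp) hs) (hM.v_zeroMean s)]
    simp [Gam, Matrix.mul_assoc]
  refine (momMat_add_right sx (hM.smul_z_secondOrder hs) (hM.smul_w_secondOrder hs)).trans ?_
  have mlam := M.measurable_lam (S := {Proc.lam}) (by simp) hs
  rw [key (S := {Proc.lam}) (by simp) (mlam.const_sub 1)
      (M.measurable_z (by simp) (by simp) (by simp) hs),
    key (S := {Proc.lam}) (by simp) mlam (M.measurable_w (by simp) hs),
    momMat_eq_zero_of_indep
      (hM.indep_sigmaOf (S := {Proc.signal}) (T := {Proc.signal}ᶜ) disjoint_compl_right)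
      (hM.sigmaOf_le _) (hM.sigmaOf_le _) (M.measurable_x (by simp) hk)
      (M.measurable_w (by simp) hs) (hM.w_zeroMean s hs), hM.integral_one_sub_lam hs, hz,
    smul_zero, add_zero]

end Hyp

end Model

end DeceptionFilter

namespace DeceptionFilter

/-! ### Sufficiency of the vectors e^a and the recursive filter. -/

namespace Model

variable {Ω : Type*} {nx nz p : ℕ} [MeasurableSpace Ω] {P : Measure Ω}
  {M : Model Ω nx nz p} {η : ℕ → Ω → Fin nz → ℝ} {j k n : ℕ}

theorem e_succ (M : Model Ω nx nz p) (P : Measure Ω) (η : ℕ → Ω → Fin nz → ℝ) (k : ℕ)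
    (a : Label) : M.e P η (k + 1) a = fun ω => M.e P η k a ω +
      (M.Psi P η a (k + 1) * (covMat P (η (k + 1)) (η (k + 1)))⁻¹) *ᵥ η (k + 1) ω := rfl

theorem T_transpose (M : Model Ω nx nz p) (P : Measure Ω) (η : ℕ → Ω → Fin nz → ℝ) (k : ℕ)
    (a b : Label) : (M.T P η k a b)ᵀ = M.T P η k b a :=
  momMat_transpose _ _

/-- `ζ` has mean zero, and its covariances with `y_1, …, y_L` are
`(1 - λ̄_s) (Gx (Γ^x_s)ᵀ + Gv (Γ^v_s)ᵀ)`. -/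
structure HasFactors (M : Model Ω nx nz p) (P : Measure Ω) (L : ℕ) (ζ : Ω → Fin n → ℝ)
    (Gx : Matrix (Fin n) (Fin (Label.x.dim p nz)) ℝ)
    (Gv : Matrix (Fin n) (Fin (Label.v.dim p nz)) ℝ) : Prop where
  secondOrder : SecondOrder P ζ
  zeroMean : ZeroMean P ζ
  momMat_y : ∀ s, 1 ≤ s → s ≤ L →
    momMat P ζ (M.y s) = (1 - M.lamBar s) • (Gx * (M.Gam .x s)ᵀ + Gv * (M.Gam .v s)ᵀ)

theorem HasFactors.mono {L L' : ℕ} {ζ : Ω → Fin n → ℝ}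
    {Gx : Matrix (Fin n) (Fin (Label.x.dim p nz)) ℝ}
    {Gv : Matrix (Fin n) (Fin (Label.v.dim p nz)) ℝ} (h : M.HasFactors P L ζ Gx Gv)
    (hL : L' ≤ L) : M.HasFactors P L' ζ Gx Gv :=
  ⟨h.secondOrder, h.zeroMean, fun s h1 h2 => h.momMat_y s h1 (h2.trans hL)⟩

/-- The vectors `e^a_k` are centred affine functions of `y_1, …, y_k`, and they yield the
least-squares linear estimator of every vector with factorized covariances. -/
structure IsSufficientAt (M : Model Ω nx nz p) (P : Measure Ω) (η : ℕ → Ω → Fin nz → ℝ)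
    (k : ℕ) : Prop where
  affine : ∀ a, IsAffineIn P M.y k (M.e P η k a)
  secondOrder : ∀ a, SecondOrder P (M.e P η k a)
  zeroMean : ∀ a, ZeroMean P (M.e P η k a)
  isOrthTo : ∀ {n : ℕ} {ζ : Ω → Fin n → ℝ} {Gx : Matrix (Fin n) (Fin (Label.x.dim p nz)) ℝ}
    {Gv : Matrix (Fin n) (Fin (Label.v.dim p nz)) ℝ}, M.HasFactors P k ζ Gx Gv →
    IsOrthTo P M.y k fun ω => ζ ω - (Gx *ᵥ M.e P η k .x ω + Gv *ᵥ M.e P η k .v ω)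

namespace Hyp

theorem innovation_affine (hη : IsInnovation P M.y η) (k : ℕ) :
    IsAffineIn P M.y k fun ω => M.y (k + 1) ω - η (k + 1) ω :=
  (hη (k + 1) (by omega)).linear

variable [IsProbabilityMeasure P]

theorem hasFactors_x (hM : M.Hyp P) (hk : 1 ≤ k) : M.HasFactors P k (M.x k) (M.A k) 0 where
  secondOrder := hM.signal_secondOrder k hk
  zeroMean := hM.signal_zeroMean k hk
  momMat_y s h1 h2 := by
    rw [hM.momMat_x_y h1 h2, Matrix.zero_mul, add_zero]

/-- Separability of the observations holds only at strictly earlier times, which is exactly what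
one-step prediction needs. -/
theorem hasFactors_y (hM : M.Hyp P) (k : ℕ) :
    M.HasFactors P k (fun ω => M.y (k + 1) ω - M.yMean (k + 1))
      ((1 - M.lamBar (k + 1)) • M.Del .x (k + 1)) ((1 - M.lamBar (k + 1)) • M.Del .v (k + 1)) where
  secondOrder := (hM.y_secondOrder (by omega)).sub (SecondOrder.const _)
  zeroMean := hM.y_sub_yMean_zeroMean (by omega)
  momMat_y _ h1 h2 := hM.momMat_y_sub_yMean h1 (by omega)

theorem innovation_isOrthTo (hM : M.Hyp P) (hη : IsInnovation P M.y η) (k : ℕ) :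
    IsOrthTo P M.y k (η (k + 1)) := by
  have h := (hη (k + 1) (by omega)).isOrthTo (fun j h1 _ => hM.y_secondOrder h1)
    (hM.y_secondOrder (by omega))
  simpa using h

/-- The innovation in terms of the vectors `e^a`. -/
theorem innovation_eq (hM : M.Hyp P) (hη : IsInnovation P M.y η) (hs : M.IsSufficientAt P η k) :
    η (k + 1) =ᵐ[P] fun ω => (M.y (k + 1) ω - M.yMean (k + 1)) -
      (((1 - M.lamBar (k + 1)) • M.Del .x (k + 1)) *ᵥ M.e P η k .x ω +
        ((1 - M.lamBar (k + 1)) • M.Del .v (k + 1)) *ᵥ M.e P η k .v ω) := by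
  have haff : IsAffineIn P M.y k fun ω => M.yMean (k + 1) +
      (((1 - M.lamBar (k + 1)) • M.Del .x (k + 1)) *ᵥ M.e P η k .x ω +
        ((1 - M.lamBar (k + 1)) • M.Del .v (k + 1)) *ᵥ M.e P η k .v ω) :=
    (IsAffineIn.const _).add (((hs.affine .x).mulVec _).add ((hs.affine .v).mulVec _))
  have hor := hs.isOrthTo (hM.hasFactors_y k)
  simp only [sub_sub] at hor
  -- Uniqueness identifies the predictor hidden in the innovation with the explicit affine one.
  have := (isLSLinearEstimator_iff_ae_eq (fun j h1 _ => hM.y_secondOrder h1)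
    (hM.y_secondOrder (by omega)) haff hor _).1 (hη (k + 1) (by omega))
  filter_upwards [this] with ω hω
  rw [sub_sub, ← hω, sub_sub_cancel]

theorem covMat_innovation (hM : M.Hyp P) (hη : IsInnovation P M.y η) (k : ℕ) :
    covMat P (η (k + 1)) (η (k + 1)) = momMat P (η (k + 1)) (η (k + 1)) :=
  covMat_eq_momMat (hM.innovation_isOrthTo hη k).secondOrder
    (hM.innovation_isOrthTo hη k).secondOrder (hM.innovation_isOrthTo hη k).zeroMean

theorem momMat_e_innovation (hM : M.Hyp P) (hη : IsInnovation P M.y η)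
    (hs : M.IsSufficientAt P η k) (a : Label) :
    momMat P (M.e P η k a) (η (k + 1)) = 0 := by
  rw [← momMat_transpose, (hM.innovation_isOrthTo hη k).momMat_affine
    (fun j h1 _ => hM.y_secondOrder h1) (hs.affine a), Matrix.transpose_zero]

/-- The error of ζ is orthogonal to e^b_k, so ζ may be replaced by its estimate Gx e^x_k + Gv e^v_k.
-/
theorem momMat_e (hM : M.Hyp P) (hs : M.IsSufficientAt P η k) {ζ : Ω → Fin n → ℝ}
    {Gx : Matrix (Fin n) (Fin (Label.x.dim p nz)) ℝ}
    {Gv : Matrix (Fin n) (Fin (Label.v.dim p nz)) ℝ} (h : M.HasFactors P k ζ Gx Gv)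
    (b : Label) :
    momMat P ζ (M.e P η k b) = Gx * M.T P η k .x b + Gv * M.T P η k .v b := by
  have h0 := (hs.isOrthTo h).momMat_affine (fun j h1 _ => hM.y_secondOrder h1) (hs.affine b)
  have sx := hs.secondOrder .x
  have sv := hs.secondOrder .v
  have sb := hs.secondOrder b
  rw [momMat_sub_left h.secondOrder ((sx.mulVec _).add (sv.mulVec _)) sb,
    momMat_add_left (sx.mulVec _) (sv.mulVec _) sb, momMat_mulVec_left _ sx sb,
    momMat_mulVec_left _ sv sb] at h0
  exact sub_eq_zero.1 h0

/-- Covariances of the next innovation with vectors having factorized covariances. -/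
theorem momMat_innovation (hM : M.Hyp P) (hη : IsInnovation P M.y η)
    (hs : M.IsSufficientAt P η k) {ζ : Ω → Fin n → ℝ}
    {Gx : Matrix (Fin n) (Fin (Label.x.dim p nz)) ℝ}
    {Gv : Matrix (Fin n) (Fin (Label.v.dim p nz)) ℝ} (h : M.HasFactors P (k + 1) ζ Gx Gv) :
    momMat P ζ (η (k + 1)) = Gx * M.Psi P η .x (k + 1) + Gv * M.Psi P η .v (k + 1) := by
  have h' := h.mono (Nat.le_succ k)
  have sζ := h.secondOrder
  have sy : SecondOrder P (M.y (k + 1)) := hM.y_secondOrder (by omega)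
  have sx := hs.secondOrder .x
  have sv := hs.secondOrder .v
  rw [momMat_congr (EventuallyEq.refl _ ζ) (hM.innovation_eq hη hs),
    momMat_sub_right sζ (sy.sub (SecondOrder.const _)) ((sx.mulVec _).add (sv.mulVec _)),
    momMat_sub_right sζ sy (SecondOrder.const _), momMat_add_right sζ (sx.mulVec _) (sv.mulVec _),
    momMat_const_right h.zeroMean, momMat_mulVec_right _ sζ sx, momMat_mulVec_right _ sζ sv,
    hM.momMat_e hs h' .x, hM.momMat_e hs h' .v, h.momMat_y (k + 1) (by omega) le_rfl]
  -- The Γ terms come from the factorization at the new time k + 1, the Δ T terms from the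
  -- predictor; the symmetry (T^{ab})ᵀ = T^{ba} matches them with the transposed gains.
  simp only [Psi, gain, Nat.add_sub_cancel, Matrix.transpose_sub, Matrix.transpose_mul,
    T_transpose M P η k .x .x, T_transpose M P η k .x .v, T_transpose M P η k .v .x,
    T_transpose M P η k .v .v, Matrix.transpose_smul, Matrix.mul_smul, Matrix.add_mul, Matrix.mul_sub, sub_zero,
    Matrix.mul_assoc]
  module

/-- With no observations, e^a = 0 and orthogonality reduces to ζ having mean zero. -/
theorem isSufficientAt_zero (M : Model Ω nx nz p) (P : Measure Ω) [IsProbabilityMeasure P]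
    (η : ℕ → Ω → Fin nz → ℝ) : M.IsSufficientAt P η 0 where
  affine _ := IsAffineIn.const 0
  secondOrder _ := SecondOrder.const 0
  zeroMean _ _ := by simp [e]
  isOrthTo h := by
    refine ⟨?_, ?_, fun j h1 h2 => by omega⟩
    · simpa [e] using h.secondOrder
    · simpa [e] using h.zeroMean

/-- The old residual is already orthogonal to the past, and so is the innovation; only the
correlation with y_{k+1} has to be removed. Since y_{k+1} - η_{k+1} is affine in the past, this
means removing the correlation with η_{k+1}, which a regression on η_{k+1} does. -/
theorem isSufficientAt_succ (hM : M.Hyp P) (hη : IsInnovation P M.y η)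
    (hs : M.IsSufficientAt P η k) (hdet : IsUnit (covMat P (η (k + 1)) (η (k + 1))).det) :
    M.IsSufficientAt P η (k + 1) := by
  have hyL : ∀ {L}, ∀ j, 1 ≤ j → j ≤ L → SecondOrder P (M.y j) :=
    fun j h1 _ => hM.y_secondOrder h1
  have oη := hM.innovation_isOrthTo hη k
  have aη : IsAffineIn P M.y (k + 1) (η (k + 1)) := by
    have := (IsAffineIn.observation (P := P) (y := M.y) (L := k + 1) (by omega) le_rfl).sub
      ((innovation_affine hη k).mono (Nat.le_succ k))
    simpa using this
  have haff : ∀ a, IsAffineIn P M.y (k + 1) (M.e P η (k + 1) a) := fun a =>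
    ((hs.affine a).mono (Nat.le_succ k)).add (aη.mulVec _)
  refine ⟨haff, fun a => (haff a).secondOrder hyL, fun a =>
    ZeroMean.add (hs.secondOrder a) (oη.secondOrder.mulVec _) (hs.zeroMean a)
      (oη.zeroMean.mulVec _ oη.secondOrder), ?_⟩
  intro n ζ Gx Gv h
  set S := covMat P (η (k + 1)) (η (k + 1)) with hS
  -- `G` is E[ζ η_{k+1}ᵀ], hence also E[R η_{k+1}ᵀ], so `G * S⁻¹` is the regression coefficient of
  -- the residual on the innovation.
  set G := Gx * M.Psi P η .x (k + 1) + Gv * M.Psi P η .v (k + 1) with hG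
  have oR := hs.isOrthTo (h.mono (Nat.le_succ k))
  set R : Ω → Fin n → ℝ :=
    fun ω => ζ ω - (Gx *ᵥ M.e P η k .x ω + Gv *ᵥ M.e P η k .v ω) with hR
  have hrepr : (fun ω => ζ ω - (Gx *ᵥ M.e P η (k + 1) .x ω + Gv *ᵥ M.e P η (k + 1) .v ω)) =
      fun ω => R ω - (G * S⁻¹) *ᵥ η (k + 1) ω := by
    funext ω
    simp only [e_succ, hR, hG, Matrix.mulVec_add, Matrix.mulVec_mulVec, Matrix.add_mul,
      Matrix.add_mulVec, Matrix.mul_assoc]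
    abel
  rw [hrepr]
  have sK : SecondOrder P fun ω => (G * S⁻¹) *ᵥ η (k + 1) ω := oη.secondOrder.mulVec _
  refine ⟨oR.secondOrder.sub sK, oR.zeroMean.sub oR.secondOrder sK
    (oη.zeroMean.mulVec _ oη.secondOrder), fun s h1 h2 => ?_⟩
  have sy := hM.y_secondOrder h1
  rw [momMat_sub_left oR.secondOrder sK sy, momMat_mulVec_left _ oη.secondOrder sy]
  rcases Nat.lt_or_ge s (k + 1) with hlt | hge
  · rw [oR.momMat_eq_zero s h1 (by omega), oη.momMat_eq_zero s h1 (by omega), Matrix.mul_zero,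
      sub_zero]
  · obtain rfl : s = k + 1 := le_antisymm h2 hge
    have ay := innovation_affine hη k
    have say := ay.secondOrder hyL
    have hsplit : M.y (k + 1) = fun ω => η (k + 1) ω + (M.y (k + 1) ω - η (k + 1) ω) := by
      funext ω
      rw [add_sub_cancel]
    have hRη : momMat P R (η (k + 1)) = G := by
      have sx := hs.secondOrder .x
      have sv := hs.secondOrder .v
      rw [hR, momMat_sub_left h.secondOrder ((sx.mulVec _).add (sv.mulVec _)) oη.secondOrder,
        momMat_add_left (sx.mulVec _) (sv.mulVec _) oη.secondOrder,
        momMat_mulVec_left _ sx oη.secondOrder, momMat_mulVec_left _ sv oη.secondOrder,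
        hM.momMat_e_innovation hη hs, hM.momMat_e_innovation hη hs, hM.momMat_innovation hη hs h]
      simp [hG]
    rw [hsplit, momMat_add_right oR.secondOrder oη.secondOrder say,
      momMat_add_right oη.secondOrder oη.secondOrder say, oR.momMat_affine hyL ay,
      oη.momMat_affine hyL ay, hRη, ← hM.covMat_innovation hη k, ← hS, add_zero, add_zero,
      Matrix.nonsing_inv_mul_cancel_right _ _ hdet, sub_self]

theorem isSufficientAt (hM : M.Hyp P) (hη : IsInnovation P M.y η) (k : ℕ)
    (hdet : ∀ j, 1 ≤ j → j ≤ k → IsUnit (covMat P (η j) (η j)).det) :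
    M.IsSufficientAt P η k := by
  induction k with
  | zero => exact isSufficientAt_zero M P η
  | succ k ih =>
    exact hM.isSufficientAt_succ hη (ih fun j h1 h2 => hdet j h1 (by omega))
      (hdet (k + 1) (by omega) le_rfl)

/-- The increment of e is orthogonal to the old e, so second moments add; in the increment's own
moment, one of the two inverses of Σ^η cancels against E[η ηᵀ] = Σ^η. -/
theorem T_succ (hM : M.Hyp P) (hη : IsInnovation P M.y η) (hs : M.IsSufficientAt P η k)
    (hdet : IsUnit (covMat P (η (k + 1)) (η (k + 1))).det) (a b : Label) :
    M.T P η (k + 1) a b = M.T P η k a b +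
      M.Psi P η a (k + 1) * (covMat P (η (k + 1)) (η (k + 1)))⁻¹ * (M.Psi P η b (k + 1))ᵀ := by
  have sη := (hM.innovation_isOrthTo hη k).secondOrder
  have sa := hs.secondOrder a
  have sb := hs.secondOrder b
  rw [T, e_succ, e_succ, momMat_add_left sa (sη.mulVec _) (sb.add (sη.mulVec _)),
    momMat_add_right sa sb (sη.mulVec _), momMat_add_right (sη.mulVec _) sb (sη.mulVec _),
    momMat_mulVec_right _ sa sη, momMat_mulVec_left _ sη sb,
    momMat_mulVec_left _ sη (sη.mulVec _), momMat_mulVec_right _ sη sη,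
    ← momMat_transpose (M.e P η k b) (η (k + 1)), hM.momMat_e_innovation hη hs,
    hM.momMat_e_innovation hη hs, ← hM.covMat_innovation hη k, Matrix.transpose_mul,
    Matrix.transpose_nonsing_inv, covMat_transpose, Matrix.mul_nonsing_inv_cancel_left _ _ hdet]
  simp [T]

/-- The covariance matrix of the innovation. -/
theorem covMat_innovation_eq (hM : M.Hyp P) (hη : IsInnovation P M.y η)
    (hs : M.IsSufficientAt P η k) :
    covMat P (η (k + 1)) (η (k + 1)) =
      momMat P (M.y (k + 1)) (M.y (k + 1)) - (1 - M.lamBar (k + 1)) ^ 2 •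
        ((M.Del .x (k + 1) * M.T P η k .x .x + M.Del .v (k + 1) * M.T P η k .v .x)
            * (M.Del .x (k + 1))ᵀ
          + (M.Del .x (k + 1) * M.T P η k .x .v + M.Del .v (k + 1) * M.T P η k .v .v)
            * (M.Del .v (k + 1))ᵀ
          + M.gamBar (k + 1) ^ 2 • Matrix.vecMulVec (M.C (k + 1)) (M.C (k + 1))) := by
  have sy : SecondOrder P (M.y (k + 1)) := hM.y_secondOrder (by omega)
  have sx := hs.secondOrder .x
  have sv := hs.secondOrder .v
  have oη := hM.innovation_isOrthTo hη k
  set U : Ω → Fin nz → ℝ := fun ω =>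
    ((1 - M.lamBar (k + 1)) • M.Del .x (k + 1)) *ᵥ M.e P η k .x ω +
      ((1 - M.lamBar (k + 1)) • M.Del .v (k + 1)) *ᵥ M.e P η k .v ω with hU
  have sU : SecondOrder P U := (sx.mulVec _).add (sv.mulVec _)
  have aU : IsAffineIn P M.y k U := ((hs.affine .x).mulVec _).add ((hs.affine .v).mulVec _)
  have zU : ZeroMean P U := ((hs.zeroMean .x).mulVec _ sx).add (sx.mulVec _) (sv.mulVec _)
    ((hs.zeroMean .v).mulVec _ sv)
  have sc : SecondOrder P fun _ : Ω => M.yMean (k + 1) := SecondOrder.const _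
  -- Innovation, centred predictor and mean are pairwise orthogonal, so E[y yᵀ] is the sum of their
  -- second moments; solving for that of η gives the formula.
  have hy : M.y (k + 1) =ᵐ[P] fun ω => η (k + 1) ω + (U ω + M.yMean (k + 1)) := by
    filter_upwards [hM.innovation_eq hη hs] with ω hω
    rw [hω]
    simp only [hU]
    abel
  have h0 : momMat P (η (k + 1)) (fun ω => U ω + M.yMean (k + 1)) = 0 :=
    oη.momMat_affine (fun j h1 _ => hM.y_secondOrder h1) (aU.add (IsAffineIn.const _))
  rw [momMat_congr hy hy, momMat_add_left oη.secondOrder (sU.add sc)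
      (oη.secondOrder.add (sU.add sc)),
    momMat_add_right oη.secondOrder oη.secondOrder (sU.add sc),
    momMat_add_right (sU.add sc) oη.secondOrder (sU.add sc),
    ← momMat_transpose (η (k + 1)) fun ω => U ω + M.yMean (k + 1), h0,
    momMat_add_left sU sc (sU.add sc), momMat_add_right sU sU sc, momMat_add_right sc sU sc,
    momMat_const_right zU, momMat_const_left zU, momMat_const_const,
    hM.covMat_innovation hη k, hU, momMat_add_left (sx.mulVec _) (sv.mulVec _) sU,
    momMat_add_right (sx.mulVec _) (sx.mulVec _) (sv.mulVec _),
    momMat_add_right (sv.mulVec _) (sx.mulVec _) (sv.mulVec _),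
    momMat_mulVec_left _ sx (sx.mulVec _), momMat_mulVec_left _ sx (sv.mulVec _),
    momMat_mulVec_left _ sv (sx.mulVec _), momMat_mulVec_left _ sv (sv.mulVec _),
    momMat_mulVec_right _ sx sx, momMat_mulVec_right _ sx sv, momMat_mulVec_right _ sv sx,
    momMat_mulVec_right _ sv sv, yMean]
  simp only [T, Matrix.transpose_zero, Matrix.transpose_smul, Matrix.smul_mul,
    Matrix.mul_smul, Matrix.mul_assoc, Matrix.smul_vecMulVec, Matrix.vecMulVec_smul,
    Matrix.add_mul]
  module

/-- The least-squares linear filter of the signal. -/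
theorem isLSLinearEstimator_signal_iff (hM : M.Hyp P) (hs : M.IsSufficientAt P η k) (hk : 1 ≤ k)
    (xhat : Ω → Fin nx → ℝ) : IsLSLinearEstimator P M.y k (M.x k) xhat ↔
      xhat =ᵐ[P] fun ω => M.A k *ᵥ M.e P η k .x ω := by
  have h := hs.isOrthTo (hM.hasFactors_x hk)
  simp only [Matrix.zero_mulVec, add_zero] at h
  exact isLSLinearEstimator_iff_ae_eq (fun j h1 _ => hM.y_secondOrder h1)
    (hM.signal_secondOrder k hk) ((hs.affine .x).mulVec _) h xhat

end Hyp

end Model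

end DeceptionFilter

/-- Recursive least-squares linear filter from linearized uncertain observations with
time-correlated noise, subject to random deception attacks. -/
theorem theorem1 {Ω : Type*} [MeasurableSpace Ω] (P : Measure Ω) [IsProbabilityMeasure P]
    {nx nz p : ℕ} (M : DeceptionFilter.Model Ω nx nz p) (hM : M.Hyp P) :
    (∃ η, DeceptionFilter.IsInnovation P M.y η) ∧
    ∀ η : ℕ → Ω → Fin nz → ℝ, DeceptionFilter.IsInnovation P M.y η →
    -- initial conditions
    (∀ a, M.e P η 0 a = 0) ∧ (∀ a b, M.T P η 0 a b = 0) ∧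
    ∀ k, 1 ≤ k →
    -- the innovation covariance matrices to be inverted are non-singular
    (∀ j, 1 ≤ j → j ≤ k → IsUnit (DeceptionFilter.covMat P (η j) (η j)).det) →
    -- all the random vectors involved are of second order
    DeceptionFilter.SecondOrder P (M.z k) ∧ DeceptionFilter.SecondOrder P (M.y k) ∧
    DeceptionFilter.SecondOrder P (η k) ∧ (∀ a, DeceptionFilter.SecondOrder P (M.e P η k a)) ∧
    -- the innovation
    (∀ᵐ ω ∂P, η k ω = M.y k ω - (1 - M.lamBar k) •
      (M.Del .x k *ᵥ M.e P η (k - 1) .x ω + M.Del .v k *ᵥ M.e P η (k - 1) .v ω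
        + M.gamBar k • M.C k)) ∧
    -- the innovation covariance matrix
    DeceptionFilter.covMat P (η k) (η k) =
      DeceptionFilter.momMat P (M.y k) (M.y k) - (1 - M.lamBar k) ^ 2 •
        ((M.Del .x k * M.T P η (k - 1) .x .x + M.Del .v k * M.T P η (k - 1) .v .x)
            * (M.Del .x k)ᵀ
          + (M.Del .x k * M.T P η (k - 1) .x .v + M.Del .v k * M.T P η (k - 1) .v .v)
            * (M.Del .v k)ᵀ
          + M.gamBar k ^ 2 • Matrix.vecMulVec (M.C k) (M.C k)) ∧
    -- the second-moment matrices of `y_k` and `z_k`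
    DeceptionFilter.momMat P (M.y k) (M.y k) =
      (1 - M.lamBar k) • DeceptionFilter.momMat P (M.z k) (M.z k)
        + M.lamBar k • M.SigmaW k ∧
    DeceptionFilter.momMat P (M.z k) (M.z k) =
      M.gamBar k • (M.H k * M.A k * (M.B k)ᵀ * (M.H k)ᵀ + Matrix.vecMulVec (M.C k) (M.C k))
        + M.E k * (M.F k)ᵀ ∧
    -- the recursion for the vectors `e^a_k`
    (∀ a ω, M.e P η k a ω = M.e P η (k - 1) a ω +
      (M.Psi P η a k * (DeceptionFilter.covMat P (η k) (η k))⁻¹) *ᵥ η k ω) ∧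
    -- the gains `Ψ^a_k`
    (∀ a, M.Psi P η a k = (1 - M.lamBar k) •
      (M.Gam a k - M.Del .x k * M.T P η (k - 1) .x a
        - M.Del .v k * M.T P η (k - 1) .v a)ᵀ) ∧
    -- the recursion for the matrices `T^{ab}_k = E[e^a_k (e^b_k)ᵀ]`
    (∀ a b, M.T P η k a b = M.T P η (k - 1) a b +
      M.Psi P η a k * (DeceptionFilter.covMat P (η k) (η k))⁻¹ * (M.Psi P η b k)ᵀ) ∧
    -- the filter: `A_k e^x_k` is, up to null sets, the unique least-squares linear estimator
    (∀ xhat : Ω → Fin nx → ℝ, DeceptionFilter.IsLSLinearEstimator P M.y k (M.x k) xhat ↔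
      xhat =ᵐ[P] fun ω => M.A k *ᵥ M.e P η k .x ω) := by
  have hy : ∀ j, 1 ≤ j → DeceptionFilter.SecondOrder P (M.y j) := fun j hj => hM.y_secondOrder hj
  refine ⟨DeceptionFilter.exists_isInnovation hy, fun η hη => ⟨fun _ => rfl, fun a b => ?_, ?_⟩⟩
  · ext i j
    simp [DeceptionFilter.Model.T, DeceptionFilter.momMat, DeceptionFilter.Model.e]
  intro k hk hdet
  -- After this shift, sufficiency at the previous time governs the innovation and the T recursion,
  -- and sufficiency at the current time the filter.
  obtain ⟨k, rfl⟩ : ∃ l, k = l + 1 := ⟨k - 1, by omega⟩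
  have hs : M.IsSufficientAt P η k :=
    hM.isSufficientAt hη k fun j h1 h2 => hdet j h1 (by omega)
  have hs' : M.IsSufficientAt P η (k + 1) := hM.isSufficientAt hη (k + 1) hdet
  refine ⟨hM.z_secondOrder hk, hy _ hk, (hM.innovation_isOrthTo hη k).secondOrder,
    hs'.secondOrder, ?_, hM.covMat_innovation_eq hη hs, hM.momMat_y_self hk,
    hM.momMat_z_self hk, fun _ _ => rfl, fun _ => rfl,
    hM.T_succ hη hs (hdet (k + 1) hk le_rfl), hM.isLSLinearEstimator_signal_iff hs' hk⟩
  filter_upwards [hM.innovation_eq hη hs] with ω hω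
  rw [hω]
  simp only [DeceptionFilter.Model.yMean, Matrix.smul_mulVec, Nat.add_sub_cancel]
  module
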